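/- **Setting.** Let $\mathfrak X$ be a separable metric space with its Borel $\sigma$-algebra (for example $\mathbb R^d$ or a compact metric space), and let $\Theta\subset\mathbb R^{t}$ be compact and non-empty. Let $(Dis_\theta)_{\theta\in\Theta}$ be a family of $1$-Lipschitz functions $Dis_\theta:\mathfrak X\to\mathbb R$ such that $\theta\mapsto Dis_\theta(x)$ is continuous on $\Theta$ for every $x$. For probability measures $F,G$ on $\mathfrak X$ put $$W(F,G)=\max_{\theta\in\Theta}\big(E_F[Dis_\theta]-E_G[Dis_\theta]\big).$$ Let $H$ (the base measure) and $G$ be probability measures on $\mathfrak X$ with $E_H[\sup_{\theta\in\Theta}|Dis_\theta|]<\infty$ and $E_G[\sup_{\theta\in\Theta}|Dis_\theta|]<\infty$. (This is automatic if $\mathfrak X$ is bounded or if the $Dis_\theta$ are uniformly bounded, and holds if $H$ and $G$ have finite first moments.) For $a>0$, a random probability measure $F$ is a Dirichlet process $DP(a,H)$ if $(F(A_1),\dots,F(A_K))\sim \mathrm{Dir}(aH(A_1),\dots,aH(A_K))$ for every finite measurable partition $A_1,\dots,A_K$ of $\mathfrak X$, $K\ge2$ (coordinates with parameter $0$ vanish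 almost surely), and $H(A)=0$ implies $F(A)=0$ almost surely. Given data $X_1,\dots,X_n$, put $$H^*=\frac{a}{a+n}H+\frac{n}{a+n}\cdot\frac1n\sum_{i=1}^n\delta_{X_i}.$$ Ishwaran's finite approximation of the posterior process $DP(a+n,H^*)$ is $F^{\mathrm{pos}}_N=\sum_{i=1}^N J^{\mathrm{pos}}_{i,N}\,\delta_{X^{\mathrm{pos}}_i}$, where, given the data, $X^{\mathrm{pos}}_1,\dots,X^{\mathrm{pos}}_N$ are i.i.d. with law $H^*$, and $(J^{\mathrm{pos}}_{1,N},\dots,J^{\mathrm{pos}}_{N,N})\sim\mathrm{Dir}(\frac{a+n}{N},\dots,\frac{a+n}{N})$ is independent of the data and of the $X^{\mathrm{pos}}_i$. Let $Y_1,\dots,Y_N$ be i.i.d. with law $G$, with empirical distribution $G_{Y_{1:N}}$, and let $$W(F^{\mathrm{pos}}_N,G_{Y_{1:N}})=\max_{\theta\in\Theta}\sum_{i=1}^N\Big(J^{\mathrm{pos}}_{i,N}\,Dis_\theta(X^{\mathrm{pos}}_i)-\frac{Dis_\theta(Y_i)}{N}\Big).$$ **Theorem.** (A) *Dirichlet process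 prior.* Suppose that $F\sim DP(a,H)$ and that, conditionally on $F$, the data $X_1,X_2,\dots$ are i.i.d. with law $F$. (i) For every fixed $a>0$, almost surely $E_F[\sup_{\theta\in\Theta}|Dis_\theta|]<\infty$, and $W(F^{\mathrm{pos}}_N,G_{Y_{1:N}})\to W(F,G)$ in probability as $N,n\to\infty$. (ii) For every fixed $n\ge0$, $W(F^{\mathrm{pos}}_N,G_{Y_{1:N}})\to W(H,G)$ in probability as $N,a\to\infty$, where for each $a$ the data come from the model with prior $DP(a,H)$. (B) *Fixed data distribution.* The limits in probability in (i) and (ii) also hold, with $F^{\mathrm{pos}}_N$ constructed from the data in the same way, if $X_1,X_2,\dots$ are i.i.d. with a fixed law $F$ such that $E_F[\sup_{\theta\in\Theta}|Dis_\theta|]<\infty$. Both limits are joint: the two indices tend to infinity independently, with no relation between their rates. -/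

import Mathlib

open MeasureTheory ProbabilityTheory Filter Topology
open scoped ENNReal

namespace BNPL

noncomputable section

/-! ### Dirichlet distributions and Dirichlet processes -/

/-- The `Gamma(α, 1)` distribution for `0 ≤ α`, where `Gamma(0, 1)` is the point mass at `0`. -/
def gammaLaw (α : ℝ) : Measure ℝ :=
  if α = 0 then Measure.dirac 0 else gammaMeasure α 1

/-- The Dirichlet distribution `Dir(α₁, …, α_K)`, for nonnegative parameters that are not all zero:
the law of `(g₁ / ∑ g_j, …, g_K / ∑ g_j)` for independent `g_j ∼ Gamma(α_j, 1)`. A coordinate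
whose parameter is `0` is almost surely `0`. -/
def dirichlet {K : ℕ} (α : Fin K → ℝ) : Measure (Fin K → ℝ) :=
  (Measure.pi fun j => gammaLaw (α j)).map fun g j => g j / ∑ k, g k

variable {𝔛 Ω : Type*} [MeasurableSpace 𝔛] [MeasurableSpace Ω]

/-- The random probability measure `F` on `𝔛` (a Markov kernel from the probability space
`(Ω, P)`) is a Dirichlet process `DP(a, H)`. -/
structure IsDirichletProcess (P : Measure Ω) (F : Kernel Ω 𝔛) (a : ℝ) (H : Measure 𝔛) : Prop where
  law_partition : ∀ (K : ℕ), 2 ≤ K → ∀ A : Fin K → Set 𝔛, (∀ j, MeasurableSet (A j)) →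
    Pairwise (fun i j => Disjoint (A i) (A j)) → (⋃ j, A j) = Set.univ →
      P.map (fun ω j => (F ω).real (A j)) = dirichlet fun j => a * H.real (A j)
  null : ∀ A : Set 𝔛, MeasurableSet A → H A = 0 → ∀ᵐ ω ∂P, F ω A = 0

/-- `X₁, X₂, …` is a sample from the random probability measure `F`: conditionally on `F`, the
variables are independent with common law `F`. -/
structure IsSampleFromRandom (P : Measure Ω) (F : Kernel Ω 𝔛) (X : ℕ → Ω → 𝔛) : Prop where
  measurable : ∀ i, Measurable (X i)
  cond_law : ∀ (n : ℕ) (A : Fin n → Set 𝔛), (∀ i, MeasurableSet (A i)) →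
    P[(⋂ i : Fin n, X i ⁻¹' A i).indicator (fun _ => (1 : ℝ)) |
        MeasurableSpace.comap (fun ω => F ω) inferInstance]
      =ᵐ[P] fun ω => ∏ i : Fin n, (F ω).real (A i)

/-- The variables `Y_i` are independent and identically distributed with law `G`. -/
structure IsIIDSample {ι : Type*} (P : Measure Ω) (G : Measure 𝔛) (Y : ι → Ω → 𝔛) : Prop where
  measurable : ∀ i, Measurable (Y i)
  indep : iIndepFun Y P
  law : ∀ i, P.map (Y i) = G

/-! ### The posterior and its finite approximation -/

/-- The empirical distribution `n⁻¹ ∑ δ_{x_i}` of the points `x₁, …, x_n`. -/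
def empirical {n : ℕ} (x : Fin n → 𝔛) : Measure 𝔛 :=
  (n : ℝ≥0∞)⁻¹ • ∑ i, Measure.dirac (x i)

/-- The posterior base measure `H* = a / (a + n) H + n / (a + n) F_{x_{1:n}}`. -/
def posteriorBase (a : ℝ) (H : Measure 𝔛) {n : ℕ} (x : Fin n → 𝔛) : Measure 𝔛 :=
  ENNReal.ofReal (a / (a + n)) • H + ENNReal.ofReal (n / (a + n)) • empirical x

/-- `Xpos` and `J` are the locations and the weights of the `N`-term approximation
`∑ J_i δ_{Xpos_i}` of the posterior Dirichlet process `DP(a + n, H*)` given the data `X₁, …, X_n`: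
given the data, the locations are independent with law `H*`, and the weights have law
`Dir((a + n) / N, …, (a + n) / N)` and are independent of the data and the locations. -/
structure IsPosteriorApprox (P : Measure Ω) (a : ℝ) (H : Measure 𝔛) {n N : ℕ}
    (X : Fin n → Ω → 𝔛) (Xpos : Fin N → Ω → 𝔛) (J : Fin N → Ω → ℝ) : Prop where
  measurable_loc : ∀ i, Measurable (Xpos i)
  measurable_weight : ∀ i, Measurable (J i)
  cond_law : ∀ A : Fin N → Set 𝔛, (∀ i, MeasurableSet (A i)) →
    P[(⋂ i, Xpos i ⁻¹' A i).indicator (fun _ => (1 : ℝ)) |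
        MeasurableSpace.comap (fun ω i => X i ω) inferInstance]
      =ᵐ[P] fun ω => ∏ i, (posteriorBase a H fun j => X j ω).real (A i)
  law_weight : P.map (fun ω i => J i ω) = dirichlet fun _ : Fin N => (a + n) / N
  indep : IndepFun (fun ω i => J i ω)
    (fun ω => ((fun i => X i ω : Fin n → 𝔛), (fun i => Xpos i ω : Fin N → 𝔛))) P

/-- The measure `∑ J_i δ_{x_i}`. -/
def weighted {N : ℕ} (J : Fin N → ℝ) (x : Fin N → 𝔛) : Measure 𝔛 :=
  ∑ i, ENNReal.ofReal (J i) • Measure.dirac (x i)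

/-! ### The Wasserstein distance over a family of discriminators -/

/-- `W(F, G) = max_{θ ∈ Θ} (E_F[Dis_θ] - E_G[Dis_θ])`. -/
def W {T : Type*} (Θ : Set T) (Dis : T → 𝔛 → ℝ) (F G : Measure 𝔛) : ℝ :=
  sSup ((fun θ => (∫ x, Dis θ x ∂F) - ∫ y, Dis θ y ∂G) '' Θ)

/-- The estimator `max_{θ ∈ Θ} ∑_{i ≤ N} (J_i Dis_θ(x_i) - Dis_θ(y_i) / N)`. -/
def WHat {S T : Type*} (Θ : Set T) (Dis : T → S → ℝ) {N : ℕ}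
    (J : Fin N → ℝ) (x y : Fin N → S) : ℝ :=
  sSup ((fun θ => ∑ i, (J i * Dis θ (x i) - Dis θ (y i) / N)) '' Θ)

/-- The envelope `x ↦ sup_{θ ∈ Θ} |Dis_θ(x)|` of the family of discriminators. -/
def envelope {S T : Type*} (Θ : Set T) (Dis : T → S → ℝ) (x : S) : ℝ :=
  sSup ((fun θ => |Dis θ x|) '' Θ)

/-- The estimator is the Wasserstein distance between the random measure `∑ J_i δ_{x_i}` and
the empirical distribution of the `y_i`. -/
theorem WHat_eq_W [MeasurableSingletonClass 𝔛] {T : Type*} (Θ : Set T) (Dis : T → 𝔛 → ℝ) {N : ℕ}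
    (J : Fin N → ℝ) (hJ : ∀ i, 0 ≤ J i) (x y : Fin N → 𝔛) :
    WHat Θ Dis J x y = W Θ Dis (weighted J x) (empirical y) := by
  unfold WHat W weighted empirical
  congr 2
  funext θ
  have hint : ∀ z : 𝔛, Integrable (Dis θ) (Measure.dirac z) := fun z =>
    integrable_dirac (by simp [enorm])
  rw [integral_finsetSum_measure fun i _ => (hint _).smul_measure ENNReal.ofReal_ne_top,
    integral_smul_measure, integral_finsetSum_measure fun i _ => hint _, Finset.sum_sub_distrib]
  simp [integral_smul_measure, integral_dirac, hJ, ENNReal.toReal_ofReal, Finset.mul_sum,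
    div_eq_inv_mul]

theorem abs_le_envelope {S T : Type*} [TopologicalSpace T] {Θ : Set T} {Dis : T → S → ℝ}
    (hΘ : IsCompact Θ) (hcont : ∀ x, ContinuousOn (fun θ => Dis θ x) Θ) {θ : T} (hθ : θ ∈ Θ) (x : S) : |Dis θ x| ≤ envelope Θ Dis x :=
  le_csSup (hΘ.bddAbove_image (hcont x).abs) ⟨θ, hθ, rfl⟩

/-- The supremum in the definition of the estimator is attained. -/
theorem WHat_isGreatest {S T : Type*} [TopologicalSpace T] {Θ : Set T} {Dis : T → S → ℝ}
    (hΘ : IsCompact Θ) (hne : Θ.Nonempty)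
    (hcont : ∀ x, ContinuousOn (fun θ => Dis θ x) Θ) {N : ℕ} (J : Fin N → ℝ) (x y : Fin N → S) :
    IsGreatest ((fun θ => ∑ i, (J i * Dis θ (x i) - Dis θ (y i) / N)) '' Θ)
      (WHat Θ Dis J x y) :=
  (hΘ.image_of_continuousOn (by
    refine continuousOn_finsetSum _ fun i _ => ?_
    exact ((hcont _).const_mul _).sub ((hcont _).div_const _))).isGreatest_sSup (hne.image _)

/-- The supremum in the definition of `W` is attained as soon as the envelope is integrable. -/
theorem W_isGreatest {T : Type*} [TopologicalSpace T] [FirstCountableTopology T] {Θ : Set T}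
    {Dis : T → 𝔛 → ℝ} (hΘ : IsCompact Θ) (hne : Θ.Nonempty)
    (hmeas : ∀ θ ∈ Θ, Measurable (Dis θ)) (hcont : ∀ x, ContinuousOn (fun θ => Dis θ x) Θ)
    {F G : Measure 𝔛} (hF : Integrable (envelope Θ Dis) F) (hG : Integrable (envelope Θ Dis) G) :
    IsGreatest ((fun θ => (∫ x, Dis θ x ∂F) - ∫ y, Dis θ y ∂G) '' Θ) (W Θ Dis F G) := by
  have key : ∀ μ : Measure 𝔛, Integrable (envelope Θ Dis) μ →
      ContinuousOn (fun θ => ∫ x, Dis θ x ∂μ) Θ := fun μ hμ =>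
    continuousOn_of_dominated (fun θ hθ => (hmeas θ hθ).aestronglyMeasurable)
      (fun θ hθ => ae_of_all _ fun x => abs_le_envelope hΘ hcont hθ x) hμ
      (ae_of_all _ hcont)
  exact (hΘ.image_of_continuousOn ((key F hF).sub (key G hG))).isGreatest_sSup (hne.image _)

end

end BNPL

/-! The estimator and its limit are both suprema over `Θ`, so their difference is at most the
largest error over `Θ` of the weighted posterior average plus that of the empirical average of the
`Y_i`. Each error is made small in mean, separately, and Markov's inequality gives convergence in
probability (`tendstoInMeasure_WHat`).

Compactness of `Θ` reduces the supremum to a finite net (`eventually_exists_uniform_bound`). What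
the net misses is controlled by the modulus of continuity in `θ`, which is at most twice the
envelope and tends to `0` pointwise, hence in mean by dominated convergence. So a weak law for
single functions suffices.

That weak law (`tendsto_lintegral_weighted_sub`) concerns `∑ J_i f(U_i)` with the `U_i` pairwise
conditionally independent with random law `κ` and independent probability weights `J`. For bounded
`f` the cross terms vanish and the second moment is at most a constant times `∑ E[J_i²]`; integrable
`f` is truncated. It serves three times: for the posterior locations with Dirichlet weights, where
`∑ E[J_i²] ≤ 1/N + 1/(a+n)`, and for the data and the `Y_i` with equal weights. One truncation works
for all indices because the mean law of `H*` is dominated by `H + Q`, with `Q` the law of one data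
point.

It remains to follow `H*` itself: its prior part has weight `a/(a+n)`, which vanishes as `n → ∞`,
and its data part has weight `n/(a+n)`, which vanishes as `a → ∞`. A Dirichlet process prior enters
through its mean `H` (`IsDirichletProcess.bind_eq`), which gives the law of each data point and the
integrability of the envelope. The error bounds depend on the two indices with no coupling, so the
limits are joint. -/

namespace BNPL

/-! ### Moments of gamma and Dirichlet laws. -/

/-- Tilting the density by `g ^ k * exp (-(t * g))` gives an unnormalised gamma density of shape `α
+ k` and rate `1 + t`; the product is the quotient `Γ(α + k) / Γ(α)`. -/
theorem lintegral_pow_mul_exp_neg_mul_gammaMeasure {α t : ℝ} (hα : 0 < α) (ht : 0 ≤ t) (k : ℕ) :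
    ∫⁻ g, ENNReal.ofReal (g ^ k * Real.exp (-(t * g))) ∂gammaMeasure α 1
      = ENNReal.ofReal ((∏ l ∈ Finset.range k, (α + l)) * (1 + t) ^ (-(α + k))) := by
  have hG : Real.Gamma (α + k) = (∏ l ∈ Finset.range k, (α + l)) * Real.Gamma α := by
    induction k with
    | zero => simp
    | succ k ih =>
      have h := Real.Gamma_add_one (s := α + k) (by positivity)
      rw [Finset.prod_range_succ, Nat.cast_succ, ← add_assoc, h, ih]
      ring
  have hGp := Real.Gamma_pos_of_pos hα
  have hkey := Real.integral_rpow_mul_exp_neg_mul_Ioi (a := α + k) (r := 1 + t)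
    (by positivity) (by positivity)
  have hint : IntegrableOn (fun g : ℝ => g ^ (α + k - 1) * Real.exp (-((1 + t) * g)))
      (Set.Ioi 0) := by
    -- A non-integrable function would have Bochner integral `0`, but the value `hkey` is positive.
    by_contra h
    have h0 := integral_undef h
    rw [hkey] at h0
    have : 0 < (1 / (1 + t)) ^ (α + k) * Real.Gamma (α + k) := by
      have := Real.Gamma_pos_of_pos (s := α + k) (by positivity)
      positivity
    exact this.ne' h0
  have hset : ∫⁻ g, ENNReal.ofReal (g ^ k * Real.exp (-(t * g))) ∂gammaMeasure α 1
      = ∫⁻ g in Set.Ioi 0, ENNReal.ofReal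
        ((Real.Gamma α)⁻¹ * (g ^ (α + k - 1) * Real.exp (-((1 + t) * g)))) := by
    rw [gammaMeasure, lintegral_withDensity_eq_lintegral_mul _
      (f := gammaPDF α 1) (measurable_gammaPDFReal α 1).ennreal_ofReal (by fun_prop),
      ← lintegral_indicator measurableSet_Ioi]
    refine lintegral_congr_ae ?_
    have h0 : ∀ᵐ g : ℝ, g ≠ 0 := Measure.ae_ne volume 0
    filter_upwards [h0] with g hg
    rcases lt_or_gt_of_ne hg with hg | hg
    · simp [gammaPDF_of_neg hg, hg.le]
    · rw [Pi.mul_apply, gammaPDF_of_nonneg hg.le, Set.indicator_of_mem (by exact hg),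
        ← ENNReal.ofReal_mul (by positivity)]
      congr 1
      have e1 : g ^ (α + k - 1) = g ^ (α - 1) * g ^ k := by
        rw [show α + k - 1 = α - 1 + k by ring, Real.rpow_add hg, Real.rpow_natCast]
      have e2 : Real.exp (-((1 + t) * g)) = Real.exp (-(1 * g)) * Real.exp (-(t * g)) := by
        rw [← Real.exp_add]; ring_nf
      rw [e1, e2, Real.one_rpow]
      ring
  rw [hset, ← ofReal_integral_eq_lintegral_ofReal (hint.const_mul _), integral_const_mul, hkey, hG]
  · congr 1
    rw [Real.rpow_neg (by positivity), one_div, Real.inv_rpow (by positivity)]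
    field_simp
  · refine (ae_restrict_iff' measurableSet_Ioi).2 (ae_of_all _ fun g (hg : 0 < g) => ?_)
    have := hg.le
    positivity

/-- The formula survives at `α = 0`: the factor `l = 0` kills every moment with `k ≥ 1`, as the
point mass at `0` does. This is what allows cells of `H`-measure zero. -/
theorem lintegral_pow_mul_exp_neg_mul_gammaLaw {α t : ℝ} (hα : 0 ≤ α) (ht : 0 ≤ t) (k : ℕ) :
    ∫⁻ g, ENNReal.ofReal (g ^ k * Real.exp (-(t * g))) ∂gammaLaw α
      = ENNReal.ofReal ((∏ l ∈ Finset.range k, (α + l)) * (1 + t) ^ (-(α + k))) := by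
  rcases hα.eq_or_lt with rfl | hα
  · rw [gammaLaw, if_pos rfl, lintegral_dirac]
    cases k with
    | zero => simp
    | succ k => simp [Finset.prod_range_succ']
  · rw [gammaLaw, if_neg hα.ne']
    exact lintegral_pow_mul_exp_neg_mul_gammaMeasure hα ht k

theorem isProbabilityMeasure_gammaLaw {α : ℝ} (hα : 0 ≤ α) :
    IsProbabilityMeasure (gammaLaw α) := by
  unfold gammaLaw
  split_ifs with h
  · infer_instance
  · exact isProbabilityMeasure_gammaMeasure (hα.lt_of_ne' h) one_pos

theorem ae_gammaLaw_nonneg (α : ℝ) : ∀ᵐ g ∂gammaLaw α, 0 ≤ g := by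
  unfold gammaLaw
  split_ifs with h
  · simp
  · rw [ae_iff, gammaMeasure, withDensity_apply _ (by measurability)]
    simp only [not_le]
    exact lintegral_gammaPDF_of_nonpos le_rfl

theorem ae_gammaLaw_ne_zero {α : ℝ} (hα : α ≠ 0) : ∀ᵐ g ∂gammaLaw α, g ≠ 0 := by
  rw [gammaLaw, if_neg hα, gammaMeasure]
  exact (withDensity_absolutelyContinuous _ _).ae_le (Measure.ae_ne volume 0)

section Pi

variable {K : ℕ} {α : Fin K → ℝ}

theorem ae_pi_gammaLaw {i : Fin K} (hα : ∀ i, 0 ≤ α i) {p : ℝ → Prop}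
    (h : ∀ᵐ g ∂gammaLaw (α i), p g) :
    ∀ᵐ g ∂Measure.pi fun j => gammaLaw (α j), p (g i) := by
  have := fun j => isProbabilityMeasure_gammaLaw (hα j)
  exact (measurePreserving_eval (fun j => gammaLaw (α j)) i).quasiMeasurePreserving.ae h

theorem ae_pi_gammaLaw_nonneg (hα : ∀ i, 0 ≤ α i) :
    ∀ᵐ g ∂Measure.pi fun j => gammaLaw (α j), ∀ i, 0 ≤ g i :=
  ae_all_iff.2 fun _ => ae_pi_gammaLaw hα (ae_gammaLaw_nonneg _)

theorem measurable_normalize :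
    Measurable fun (g : Fin K → ℝ) j => g j / ∑ k, g k := by
  fun_prop

theorem ae_dirichlet_nonneg (hα : ∀ i, 0 ≤ α i) : ∀ᵐ x ∂dirichlet α, ∀ i, 0 ≤ x i := by
  rw [dirichlet, ae_map_iff measurable_normalize.aemeasurable (by measurability)]
  filter_upwards [ae_pi_gammaLaw_nonneg hα] with g hg i
  exact div_nonneg (hg i) (Finset.sum_nonneg fun j _ => hg j)

theorem ae_dirichlet_sum_eq_one (hα : ∀ i, 0 ≤ α i) {i : Fin K} (hi : α i ≠ 0) :
    ∀ᵐ x ∂dirichlet α, ∑ j, x j = 1 := by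
  rw [dirichlet, ae_map_iff measurable_normalize.aemeasurable (by measurability)]
  filter_upwards [ae_pi_gammaLaw_nonneg hα, ae_pi_gammaLaw hα (ae_gammaLaw_ne_zero hi)]
    with g hg hgi
  rw [← Finset.sum_div]
  refine div_self (ne_of_gt ?_)
  exact Finset.sum_pos' (fun j _ => hg j) ⟨i, Finset.mem_univ _, (hg i).lt_of_ne' hgi⟩

/-- The moments of a Dirichlet law as one-dimensional integrals, from
`S ^ (-(m + 1)) = ∫ t ^ m / m! * exp (-t * S)` and Tonelli's theorem. -/
theorem lintegral_pow_dirichlet (hα : ∀ i, 0 ≤ α i) (i : Fin K) (m : ℕ) :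
    ∫⁻ x, ENNReal.ofReal (x i ^ (m + 1)) ∂dirichlet α
      = ∫⁻ t in Set.Ioi (0 : ℝ), ENNReal.ofReal (t ^ m / m.factorial *
        ((∏ l ∈ Finset.range (m + 1), (α i + l)) * (1 + t) ^ (-(∑ j, α j + (m + 1))))) := by
  have hprob := fun j => isProbabilityMeasure_gammaLaw (hα j)
  rw [dirichlet, lintegral_map (by fun_prop) measurable_normalize]
  have hpt : ∀ g : Fin K → ℝ, (∀ j, 0 ≤ g j) → ENNReal.ofReal ((g i / ∑ k, g k) ^ (m + 1))
      = ∫⁻ t in Set.Ioi (0 : ℝ), ENNReal.ofReal (t ^ m / m.factorial *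
        (g i ^ (m + 1) * Real.exp (-(t * ∑ k, g k)))) := by
    intro g hg
    rcases (Finset.sum_nonneg fun j _ => hg j : 0 ≤ ∑ k, g k).eq_or_lt with hS | hS
    -- If the total is `0` then so is `g i`, and both sides vanish, the left one through `0 / 0 =
    -- 0`.
    · have : g i = 0 := (Finset.sum_eq_zero_iff_of_nonneg fun j _ => hg j).1 hS.symm i
        (Finset.mem_univ _)
      simp [this]
    · set S := ∑ k, g k
      have hkey := Real.integral_rpow_mul_exp_neg_mul_Ioi (a := m + 1) (r := S) (by positivity) hS
      have hkey' : ∫ t in Set.Ioi (0 : ℝ), t ^ m / m.factorial *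
          (g i ^ (m + 1) * Real.exp (-(t * S))) = (g i / S) ^ (m + 1) := by
        have : ∀ t : ℝ, t ^ m / m.factorial * (g i ^ (m + 1) * Real.exp (-(t * S)))
            = (g i ^ (m + 1) / m.factorial) * (t ^ ((m : ℝ) + 1 - 1) * Real.exp (-(S * t))) := by
          intro t
          rw [add_sub_cancel_right, Real.rpow_natCast, mul_comm S t]
          ring
        simp_rw [this]
        rw [integral_const_mul, hkey, Real.Gamma_nat_eq_factorial]
        rw [show ((m : ℝ) + 1) = ((m + 1 : ℕ) : ℝ) by push_cast; ring, Real.rpow_natCast]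
        have := m.factorial_ne_zero
        field_simp
        rw [← mul_pow, mul_one_div]
      rw [← hkey', ofReal_integral_eq_lintegral_ofReal]
      · by_contra h
        have h0 := integral_undef h
        rcases (hg i).eq_or_lt with h1 | h1
        · exact h (by simp [← h1])
        · rw [hkey'] at h0
          exact (by positivity : (g i / S) ^ (m + 1) ≠ 0) h0
      · refine (ae_restrict_iff' measurableSet_Ioi).2 (ae_of_all _ fun t (ht : 0 < t) => ?_)
        have := hg i
        positivity
  rw [lintegral_congr_ae ((ae_pi_gammaLaw_nonneg hα).mono hpt),
    lintegral_lintegral_swap (by fun_prop)]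
  refine setLIntegral_congr_fun measurableSet_Ioi fun t ht => ?_
  have ht : 0 ≤ t := le_of_lt ht
  -- The exponent `m + 1` sits at coordinate `i` only, so that the integrand becomes a product of
  -- functions of single coordinates and independence applies.
  set c : Fin K → ℕ := fun j => if j = i then m + 1 else 0 with hc
  set φ : Fin K → ℝ → ℝ≥0∞ := fun j g => ENNReal.ofReal (g ^ c j * Real.exp (-(t * g))) with hφ
  have hprod : ∀ g : Fin K → ℝ, (∀ j, 0 ≤ g j) →
      ENNReal.ofReal (t ^ m / m.factorial * (g i ^ (m + 1) * Real.exp (-(t * ∑ k, g k))))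
        = ENNReal.ofReal (t ^ m / m.factorial) * ∏ j, φ j (g j) := by
    intro g hg
    rw [ENNReal.ofReal_mul (by positivity), hφ,
      ← ENNReal.ofReal_prod_of_nonneg fun j _ => by have := hg j; positivity,
      Finset.prod_mul_distrib, Finset.mul_sum, ← Finset.sum_neg_distrib, Real.exp_sum]
    simp [hc, pow_ite, Finset.prod_ite_eq']
  rw [lintegral_congr_ae ((ae_pi_gammaLaw_nonneg hα).mono hprod),
    lintegral_const_mul _ (by fun_prop)]
  have hind : ∫⁻ g, ∏ j, φ j (g j) ∂(Measure.pi fun j => gammaLaw (α j))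
      = ∏ j, ∫⁻ g, φ j (g j) ∂(Measure.pi fun j => gammaLaw (α j)) := by
    refine lintegral_prod_eq_prod_lintegral_of_indepFun Finset.univ
      (fun j (g : Fin K → ℝ) => φ j (g j)) ?_
      fun j => by fun_prop
    exact iIndepFun_pi fun j => (by fun_prop : Measurable (φ j)).aemeasurable
  have hj : ∀ j, ∫⁻ g, φ j (g j) ∂(Measure.pi fun j => gammaLaw (α j))
      = ENNReal.ofReal ((∏ l ∈ Finset.range (c j), (α j + l)) * (1 + t) ^ (-(α j + c j))) := by
    intro j
    rw [(measurePreserving_eval (fun j => gammaLaw (α j)) j).lintegral_comp (f := φ j)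
      (by fun_prop)]
    exact lintegral_pow_mul_exp_neg_mul_gammaLaw (hα j) ht _
  rw [hind, Finset.prod_congr rfl fun j _ => hj j,
    ← ENNReal.ofReal_prod_of_nonneg fun j _ => ?_, ← ENNReal.ofReal_mul (by positivity),
    Finset.prod_mul_distrib]
  · congr 3
    · rw [Finset.prod_eq_single i (fun j _ hj => by simp [hc, hj]) (by simp)]
      simp [hc]
    · rw [← Real.rpow_sum_of_pos (by positivity)]
      congr 1
      rw [Finset.sum_neg_distrib, Finset.sum_add_distrib]
      simp [hc]
  · have := hα j
    positivity

theorem integrableOn_one_add_rpow {p : ℝ} (hp : 0 < p) :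
    IntegrableOn (fun t : ℝ => (1 + t) ^ (-(p + 1))) (Set.Ioi 0) ∧
      ∫ t in Set.Ioi (0 : ℝ), (1 + t) ^ (-(p + 1)) = 1 / p := by
  have hd : ∀ t ∈ Set.Ici (0 : ℝ), HasDerivAt (fun t : ℝ => -(1 / p) * (1 + t) ^ (-p))
      ((1 + t) ^ (-(p + 1))) t := by
    intro t ht
    have ht : (0 : ℝ) ≤ t := ht
    have h1 := ((hasDerivAt_id t).const_add 1).rpow_const (p := -p) (Or.inl (by simp; positivity))
    convert! h1.const_mul (-(1 / p)) using 1
    simp only [id]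
    rw [show -p - 1 = -(p + 1) by ring]
    field_simp
  have hlim : Tendsto (fun t : ℝ => -(1 / p) * (1 + t) ^ (-p)) atTop (𝓝 (-(1 / p) * 0)) :=
    ((tendsto_rpow_neg_atTop hp).comp (tendsto_atTop_add_const_left _ _ tendsto_id)).const_mul _
  have hpos : ∀ t ∈ Set.Ioi (0 : ℝ), (0 : ℝ) ≤ (1 + t) ^ (-(p + 1)) := fun t ht =>
    Real.rpow_nonneg (by have : (0 : ℝ) < t := ht; positivity) _
  refine ⟨integrableOn_Ioi_deriv_of_nonneg' hd hpos hlim, ?_⟩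
  rw [integral_Ioi_of_hasDerivAt_of_nonneg' hd hpos hlim]
  simp

theorem lintegral_dirichlet (hα : ∀ i, 0 ≤ α i) (hs : 0 < ∑ j, α j) (i : Fin K) :
    ∫⁻ x, ENNReal.ofReal (x i) ∂dirichlet α = ENNReal.ofReal (α i / ∑ j, α j) := by
  have h := lintegral_pow_dirichlet hα i 0
  obtain ⟨h1, h2⟩ := integrableOn_one_add_rpow hs
  simp only [zero_add, pow_one, pow_zero, Nat.factorial_zero, Nat.cast_one, div_one, one_mul,
    Finset.prod_range_one, Nat.cast_zero, add_zero] at h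
  rw [h, ← ofReal_integral_eq_lintegral_ofReal (h1.const_mul _), integral_const_mul, h2]
  · congr 1; ring
  · refine (ae_restrict_iff' measurableSet_Ioi).2 (ae_of_all _ fun t (ht : 0 < t) => ?_)
    have := hα i
    positivity

theorem lintegral_sq_dirichlet (hα : ∀ i, 0 ≤ α i) (hs : 0 < ∑ j, α j) (i : Fin K) :
    ∫⁻ x, ENNReal.ofReal (x i ^ 2) ∂dirichlet α
      = ENNReal.ofReal (α i * (α i + 1) / ((∑ j, α j) * (∑ j, α j + 1))) := by
  have h := lintegral_pow_dirichlet hα i 1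
  set s := ∑ j, α j
  obtain ⟨h1, h2⟩ := integrableOn_one_add_rpow hs
  obtain ⟨h3, h4⟩ := integrableOn_one_add_rpow (add_pos hs one_pos)
  -- Writing `t = (1 + t) - 1` turns the integral into `1 / s - 1 / (s + 1)`.
  have e : ∀ t ∈ Set.Ioi (0 : ℝ), t ^ 1 / (Nat.factorial 1 : ℝ) *
      ((∏ l ∈ Finset.range (1 + 1), (α i + l)) * (1 + t) ^ (-(s + ((1 : ℕ) + 1))))
      = (α i * (α i + 1)) * ((1 + t) ^ (-(s + 1)) - (1 + t) ^ (-(s + 1 + 1))) := by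
    intro t ht
    have ht : (0 : ℝ) < 1 + t := by have : (0 : ℝ) < t := ht; positivity
    have : (1 + t) ^ (-(s + 1)) = (1 + t) ^ (-(s + 1 + 1)) * (1 + t) := by
      nth_rewrite 3 [← Real.rpow_one (1 + t)]
      rw [← Real.rpow_add ht]; ring_nf
    rw [this]
    simp only [Finset.prod_range_succ, Finset.prod_range_zero, Nat.cast_zero, Nat.cast_one,
      Nat.factorial_one]
    rw [show s + 1 + 1 = s + (1 + 1) by ring]
    ring
  rw [h, setLIntegral_congr_fun measurableSet_Ioi fun t ht => by rw [e t ht],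
    ← ofReal_integral_eq_lintegral_ofReal (Integrable.const_mul
      (f := fun t : ℝ => (1 + t) ^ (-(s + 1)) - (1 + t) ^ (-(s + 1 + 1))) (h1.sub h3) _),
    integral_const_mul,
    integral_sub h1 h3, h2, h4]
  · congr 1; field_simp; ring
  · refine (ae_restrict_iff' measurableSet_Ioi).2 (ae_of_all _ fun t ht => ?_)
    have := hα i
    have ht' : (0 : ℝ) < t := ht
    refine le_of_le_of_eq ?_ (e t ht)
    change (0 : ℝ) ≤ _
    positivity

end Pi

/-! ### Conditionally independent samples. -/

/-- Conditionally on `m`, each `U i` has law `κ`, and the `U i` are pairwise conditionally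
independent; of the latter only the joint laws of the pairs are recorded. -/
structure IsCondSample {Ω 𝔛 ι : Type*} (m : MeasurableSpace Ω) {mΩ : MeasurableSpace Ω}
    [MeasurableSpace 𝔛] (P : Measure Ω) (κ : Kernel Ω 𝔛) (U : ι → Ω → 𝔛) : Prop where
  le : m ≤ mΩ
  measurable_kernel : ∀ A, MeasurableSet A → Measurable[m] fun ω => κ ω A
  measurable : ∀ i, Measurable (U i)
  cond_law : ∀ i A, MeasurableSet A →
    P[(U i ⁻¹' A).indicator (fun _ => (1 : ℝ)) | m] =ᵐ[P] fun ω => (κ ω).real A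
  pair_law : ∀ i j, i ≠ j → ∀ A B, MeasurableSet A → MeasurableSet B →
    P (U i ⁻¹' A ∩ U j ⁻¹' B) = ∫⁻ ω, κ ω A * κ ω B ∂P

theorem integral_bind {Ω 𝔛 : Type*} {mΩ : MeasurableSpace Ω} [MeasurableSpace 𝔛] {P : Measure Ω}
    {κ : Kernel Ω 𝔛} {f : 𝔛 → ℝ} (hf : Integrable f (P.bind κ)) :
    ∫ x, f x ∂P.bind κ = ∫ ω, ∫ x, f x ∂κ ω ∂P := by
  rw [Measure.comp_eq_comp_const_apply] at hf ⊢
  rw [Kernel.integral_comp hf, Kernel.const_apply]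

theorem integrable_of_abs_le {Ω : Type*} {mΩ : MeasurableSpace Ω} {P : Measure Ω}
    [IsFiniteMeasure P] {f : Ω → ℝ} (hf : Measurable f) {M : ℝ} (hM : ∀ x, |f x| ≤ M) :
    Integrable f P :=
  .of_bound hf.aestronglyMeasurable M (ae_of_all _ hM)

theorem abs_integral_le_of_abs_le {Ω : Type*} {mΩ : MeasurableSpace Ω} {P : Measure Ω}
    [IsProbabilityMeasure P] {f : Ω → ℝ} {M : ℝ} (hM : ∀ x, |f x| ≤ M) :
    |∫ x, f x ∂P| ≤ M := by
  simpa using norm_integral_le_of_norm_le_const (μ := P)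
    (ae_of_all _ fun x => (Real.norm_eq_abs _).le.trans (hM x))

theorem IsCondSample.stronglyMeasurable_integral {Ω 𝔛 ι : Type*} {m mΩ : MeasurableSpace Ω}
    [MeasurableSpace 𝔛] {P : Measure Ω} {κ : Kernel Ω 𝔛} {U : ι → Ω → 𝔛}
    (h : IsCondSample m P κ U) {f : 𝔛 → ℝ} (hf : Measurable f) :
    StronglyMeasurable[m] fun ω => ∫ x, f x ∂κ ω := by
  -- The same measures, regarded as a kernel from `(Ω, m)`, so that measurability holds for the
  -- smaller σ-algebra.
  let κ' : @Kernel Ω 𝔛 m _ :=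
    @Kernel.mk Ω 𝔛 m _ κ (@Measure.measurable_of_measurable_coe 𝔛 Ω _ m κ h.measurable_kernel)
  exact @StronglyMeasurable.integral_kernel Ω 𝔛 m _ κ' ℝ _ _ f hf.stronglyMeasurable

namespace IsCondSample

variable {Ω 𝔛 ι : Type*} {m mΩ : MeasurableSpace Ω} [MeasurableSpace 𝔛] {P : Measure Ω}
  [IsProbabilityMeasure P] {κ : Kernel Ω 𝔛} [IsMarkovKernel κ] {U : ι → Ω → 𝔛}

/-- Taking all but one or two of the sets to be the whole space yields both fields; the pair law
follows by integrating out the conditioning. -/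
theorem of_iInter [Fintype ι] (hm : m ≤ mΩ)
    (hκ : ∀ A, MeasurableSet A → Measurable[m] fun ω => κ ω A) (hU : ∀ i, Measurable (U i))
    (h : ∀ A : ι → Set 𝔛, (∀ i, MeasurableSet (A i)) →
      P[(⋂ i, U i ⁻¹' A i).indicator (fun _ => (1 : ℝ)) | m] =ᵐ[P] fun ω => ∏ i, (κ ω).real (A i)) :
    IsCondSample m P κ U where
  le := hm
  measurable_kernel := hκ
  measurable := hU
  cond_law i A hA := by
    classical
    have := h (fun j => if j = i then A else Set.univ) fun j => by split_ifs <;> simp [hA]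
    have e1 : (⋂ j, U j ⁻¹' (if j = i then A else Set.univ)) = U i ⁻¹' A := by
      ext ω; simp [apply_ite]
    rw [e1] at this
    simpa [apply_ite, Finset.prod_ite_eq'] using this
  pair_law i j hij A B hA hB := by
    classical
    set C : ι → Set 𝔛 := fun k => if k = i then A else if k = j then B else Set.univ with hC
    have hCm : ∀ k, MeasurableSet (C k) := fun k => by
      simp only [hC]; split_ifs <;> simp [hA, hB]
    have e1 : (⋂ k, U k ⁻¹' C k) = U i ⁻¹' A ∩ U j ⁻¹' B := by
      ext ω
      simp only [hC, Set.mem_iInter, Set.mem_preimage, Set.mem_inter_iff]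
      refine ⟨fun h => ⟨by simpa using h i, by simpa [hij.symm] using h j⟩, fun h k => ?_⟩
      split_ifs with h1 h2
      · exact h1 ▸ h.1
      · exact h2 ▸ h.2
      · trivial
    have e2 : ∀ ω, ∏ k, (κ ω).real (C k) = (κ ω).real A * (κ ω).real B := by
      intro ω
      rw [← Finset.prod_subset (Finset.subset_univ {i, j}), Finset.prod_pair hij]
      · simp [hC, hij.symm]
      · intro k _ hk
        simp only [Finset.mem_insert, Finset.mem_singleton, not_or] at hk
        simp [hC, hk.1, hk.2]
    have hS : MeasurableSet (U i ⁻¹' A ∩ U j ⁻¹' B) := (hU i hA).inter (hU j hB)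
    have h1 := h C hCm
    simp only [e1, e2] at h1
    have h2 : ∫ ω, (κ ω).real A * (κ ω).real B ∂P = P.real (U i ⁻¹' A ∩ U j ⁻¹' B) := by
      rw [← integral_congr_ae h1, integral_condExp hm, integral_indicator_const _ hS]
      simp
    have hpos : ∀ ω, 0 ≤ (κ ω).real A * (κ ω).real B := fun ω => by positivity
    rw [← ofReal_measureReal, ← h2, ofReal_integral_eq_lintegral_ofReal]
    · refine lintegral_congr fun ω => ?_
      rw [ENNReal.ofReal_mul measureReal_nonneg, ofReal_measureReal, ofReal_measureReal]
    · refine integrable_of_abs_le (M := 1) ?_ fun ω => ?_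
      · exact ((κ.measurable_coe hA).ennreal_toReal).mul (κ.measurable_coe hB).ennreal_toReal
      · rw [abs_of_nonneg (hpos ω)]
        exact mul_le_one₀ measureReal_le_one measureReal_nonneg measureReal_le_one
    · exact ae_of_all _ hpos

/-- Integrating `cond_law` over `C` turns a family of almost sure identities, one for each `A`, into
one equality of measures, which then applies to functions directly. -/
theorem map_restrict (h : IsCondSample m P κ U) (i : ι) {C : Set Ω} (hC : MeasurableSet[m] C) :
    (P.restrict C).map (U i) = (P.restrict C).bind κ := by
  ext A hA
  have hUA := h.measurable i hA
  have h1 := setIntegral_condExp h.le (μ := P)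
    (f := (U i ⁻¹' A).indicator (fun _ => (1 : ℝ))) ((integrable_const _).indicator hUA) hC
  rw [setIntegral_congr_ae (h.le C hC) ((h.cond_law i A hA).mono fun ω hω _ => hω),
    integral_indicator_const _ hUA] at h1
  rw [Measure.map_apply (h.measurable i) hA, Measure.bind_apply hA κ.aemeasurable,
    ← ofReal_measureReal]
  simp only [smul_eq_mul, mul_one] at h1
  rw [← h1, ofReal_integral_eq_lintegral_ofReal]
  · simp
  · exact integrable_of_abs_le (M := 1) (κ.measurable_coe hA).ennreal_toReal fun ω => by
      rw [abs_of_nonneg measureReal_nonneg]; exact measureReal_le_one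
  · exact ae_of_all _ fun _ => measureReal_nonneg

theorem map_eq (h : IsCondSample m P κ U) (i : ι) : P.map (U i) = P.bind κ := by
  simpa using h.map_restrict i (C := Set.univ) MeasurableSet.univ

theorem condExp_comp (h : IsCondSample m P κ U) (i : ι) {f : 𝔛 → ℝ} (hf : Measurable f) {M : ℝ}
    (hM : ∀ x, |f x| ≤ M) :
    P[fun ω => f (U i ω) | m] =ᵐ[P] fun ω => ∫ x, f x ∂κ ω := by
  have hm := h.le
  have hκ := h.stronglyMeasurable_integral hf
  have hfU : Measurable fun ω => f (U i ω) := hf.comp (h.measurable i)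
  refine (ae_eq_condExp_of_forall_setIntegral_eq hm
    (integrable_of_abs_le hfU fun ω => hM _) ?_ ?_ hκ.aestronglyMeasurable).symm
  · intro s _ _
    exact (integrable_of_abs_le (hκ.mono hm).measurable
      fun ω => abs_integral_le_of_abs_le hM).integrableOn
  · intro C hC _
    rw [← integral_map (h.measurable i).aemeasurable hf.aestronglyMeasurable,
      h.map_restrict i hC, integral_bind]
    rw [← h.map_restrict i hC]
    have : IsFiniteMeasure ((P.restrict C).map (U i)) := Measure.isFiniteMeasure_map _ _
    exact integrable_of_abs_le hf hM

theorem integral_comp_mul (h : IsCondSample m P κ U) (i : ι) {f g : 𝔛 → ℝ} (hf : Measurable f)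
    (hg : Measurable g) {M : ℝ} (hM : ∀ x, |f x| ≤ M) (hN : ∀ x, |g x| ≤ M) :
    ∫ ω, f (U i ω) * ∫ x, g x ∂κ ω ∂P = ∫ ω, (∫ x, f x ∂κ ω) * ∫ x, g x ∂κ ω ∂P := by
  have hm := h.le
  have hκ := h.stronglyMeasurable_integral hg
  have hfU : Measurable fun ω => f (U i ω) := hf.comp (h.measurable i)
  have hint : Integrable (fun ω => f (U i ω)) P := integrable_of_abs_le hfU fun ω => hM _
  have h1 := condExp_mul_of_stronglyMeasurable_right (μ := P) hκ (f := fun ω => f (U i ω))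
    (hint.mul_bdd (c := M) (hκ.mono hm).aestronglyMeasurable
      (ae_of_all _ fun ω => abs_integral_le_of_abs_le hN)) hint
  calc _ = ∫ ω, (P[(fun ω => f (U i ω)) * fun ω => ∫ x, g x ∂κ ω | m]) ω ∂P :=
        (integral_condExp hm).symm
    _ = _ := by
        refine integral_congr_ae ?_
        filter_upwards [h1, h.condExp_comp i hf hM] with ω hω1 hω2
        rw [hω1, Pi.mul_apply, hω2]

theorem map_pair (h : IsCondSample m P κ U) {i j : ι} (hij : i ≠ j) :
    P.map (fun ω => (U i ω, U j ω)) = P.bind (κ ×ₖ κ) := by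
  have hU := (h.measurable i).prodMk (h.measurable j)
  have := Measure.isProbabilityMeasure_map (μ := P) hU.aemeasurable
  refine Measure.ext_prod fun {A B} hA hB => ?_
  rw [Measure.map_apply hU (hA.prod hB), Measure.bind_apply (hA.prod hB) (Kernel.aemeasurable _)]
  simp_rw [Kernel.prod_apply, Measure.prod_prod]
  exact h.pair_law i j hij A B hA hB

theorem integral_mul_comp (h : IsCondSample m P κ U) {i j : ι} (hij : i ≠ j) {f : 𝔛 → ℝ}
    (hf : Measurable f) {M : ℝ} (hM : ∀ x, |f x| ≤ M) :
    ∫ ω, f (U i ω) * f (U j ω) ∂P = ∫ ω, (∫ x, f x ∂κ ω) * ∫ x, f x ∂κ ω ∂P := by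
  have hU := (h.measurable i).prodMk (h.measurable j)
  have := Measure.isProbabilityMeasure_map (μ := P) hU.aemeasurable
  have hff : Measurable fun z : 𝔛 × 𝔛 => f z.1 * f z.2 := by fun_prop
  have hM0 : ∀ z : 𝔛 × 𝔛, |f z.1 * f z.2| ≤ M * M := fun z => by
    rw [abs_mul]
    exact mul_le_mul (hM _) (hM _) (abs_nonneg _) ((abs_nonneg _).trans (hM z.1))
  rw [← integral_map (φ := fun ω => (U i ω, U j ω)) (f := fun z : 𝔛 × 𝔛 => f z.1 * f z.2)
    hU.aemeasurable hff.aestronglyMeasurable, h.map_pair hij, integral_bind]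
  · simp_rw [Kernel.prod_apply, integral_prod_mul]
  · rw [← h.map_pair hij]
    exact integrable_of_abs_le hff hM0

/-- After expansion, all four products have the same expectation, that of the squared conditional
mean. -/
theorem integral_centered_mul (h : IsCondSample m P κ U) {i j : ι} (hij : i ≠ j) {f : 𝔛 → ℝ}
    (hf : Measurable f) {M : ℝ} (hM : ∀ x, |f x| ≤ M) :
    ∫ ω, (f (U i ω) - ∫ x, f x ∂κ ω) * (f (U j ω) - ∫ x, f x ∂κ ω) ∂P = 0 := by
  have hκ := ((h.stronglyMeasurable_integral hf).mono h.le).measurable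
  have hfU : ∀ i, Measurable fun ω => f (U i ω) := fun i => hf.comp (h.measurable i)
  have hκM : ∀ ω, |∫ x, f x ∂κ ω| ≤ M := fun ω => abs_integral_le_of_abs_le hM
  have key : ∀ {u v : Ω → ℝ}, Measurable u → Measurable v → (∀ ω, |u ω| ≤ M) → (∀ ω, |v ω| ≤ M) →
      Integrable (fun ω => u ω * v ω) P := fun {u v} hu hv hu' hv' =>
    integrable_of_abs_le (M := M * M) (hu.mul hv) fun ω => by
      rw [abs_mul]
      exact mul_le_mul (hu' ω) (hv' ω) (abs_nonneg _) ((abs_nonneg _).trans (hu' ω))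
  have e : ∀ ω, (f (U i ω) - ∫ x, f x ∂κ ω) * (f (U j ω) - ∫ x, f x ∂κ ω)
      = f (U i ω) * f (U j ω) - f (U i ω) * (∫ x, f x ∂κ ω) -
        (f (U j ω) * (∫ x, f x ∂κ ω) - (∫ x, f x ∂κ ω) * ∫ x, f x ∂κ ω) := fun ω => by ring
  simp_rw [e]
  have k1 := key (hfU i) (hfU j) (fun _ => hM _) (fun _ => hM _)
  have k2 := key (hfU i) hκ (fun _ => hM _) hκM
  have k3 := key (hfU j) hκ (fun _ => hM _) hκM
  have k4 := key hκ hκ hκM hκM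
  refine (integral_sub (k1.sub k2) (k3.sub k4)).trans ?_
  have e1 := integral_sub k1 k2
  have e2 := integral_sub k3 k4
  rw [h.integral_mul_comp hij hf hM, h.integral_comp_mul i hf hf hM hM, sub_self] at e1
  rw [h.integral_comp_mul j hf hf hM hM, sub_self] at e2
  exact (congrArg₂ _ e1 e2).trans (sub_self 0)

end IsCondSample

/-! ### Weak law of large numbers for weighted samples. -/

/-- Random weights `J` that form a probability vector and are independent of a sample `U` and of
the information `m`. -/
structure IsIndepWeight {Ω 𝔛 ι : Type*} [Fintype ι] (m : MeasurableSpace Ω)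
    {mΩ : MeasurableSpace Ω} [MeasurableSpace 𝔛] (P : Measure Ω) (U : ι → Ω → 𝔛)
    (J : ι → Ω → ℝ) : Prop where
  measurable : ∀ i, Measurable (J i)
  nonneg : ∀ᵐ ω ∂P, ∀ i, 0 ≤ J i ω
  sum_eq_one : ∀ᵐ ω ∂P, ∑ i, J i ω = 1
  indep : Indep (MeasurableSpace.comap (fun ω i => J i ω) inferInstance)
    (m ⊔ MeasurableSpace.comap (fun ω i => U i ω) inferInstance) P

/-- Passes from a second moment to a first moment; `η` is chosen first, and the second moment is
then small compared with it. -/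
theorem abs_le_add_sq_div (x : ℝ) {η : ℝ} (hη : 0 < η) : |x| ≤ η + x ^ 2 / η := by
  rw [← sub_nonneg, ← sq_abs]
  have : η + |x| ^ 2 / η - |x| = ((|x| - η) ^ 2 + |x| * η) / η := by
    field_simp; ring
  rw [this]
  positivity

namespace IsCondSample

variable {Ω 𝔛 ι : Type*} {m mΩ : MeasurableSpace Ω} [MeasurableSpace 𝔛] {P : Measure Ω}
  [IsProbabilityMeasure P] {κ : Kernel Ω 𝔛} [IsMarkovKernel κ] {U : ι → Ω → 𝔛}
  [Fintype ι] {J : ι → Ω → ℝ}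

/-- In the expanded square the weights factor out by independence, the off-diagonal terms vanish by
`integral_centered_mul`, and each centred variable is at most `2 * M` in absolute value. -/
theorem integral_sq_weighted_le (h : IsCondSample m P κ U) (hJ : IsIndepWeight m P U J)
    {f : 𝔛 → ℝ} (hf : Measurable f) {M : ℝ} (hM : ∀ x, |f x| ≤ M) :
    Integrable (fun ω => (∑ i, J i ω * (f (U i ω) - ∫ x, f x ∂κ ω)) ^ 2) P ∧
    ∫ ω, (∑ i, J i ω * (f (U i ω) - ∫ x, f x ∂κ ω)) ^ 2 ∂P
      ≤ 4 * M ^ 2 * ∑ i, ∫ ω, J i ω ^ 2 ∂P := by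
  set Z : ι → Ω → ℝ := fun i ω => f (U i ω) - ∫ x, f x ∂κ ω with hZ
  have hκm := h.stronglyMeasurable_integral hf
  have hκ := (hκm.mono h.le).measurable
  have hfU : ∀ i, Measurable fun ω => f (U i ω) := fun i => hf.comp (h.measurable i)
  have hZm : ∀ i, Measurable (Z i) := fun i => (hfU i).sub hκ
  have hZM : ∀ i ω, |Z i ω| ≤ 2 * M := fun i ω => by
    have h1 := hM (U i ω)
    have h2 : |∫ x, f x ∂κ ω| ≤ M := abs_integral_le_of_abs_le hM
    calc |Z i ω| ≤ |f (U i ω)| + |∫ x, f x ∂κ ω| := abs_sub _ _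
      _ ≤ 2 * M := by linarith
  have hJ1 : ∀ᵐ ω ∂P, ∀ i, |J i ω| ≤ 1 := by
    filter_upwards [hJ.nonneg, hJ.sum_eq_one] with ω h0 h1 i
    rw [abs_of_nonneg (h0 i), ← h1]
    exact Finset.single_le_sum (f := fun i => J i ω) (fun j _ => h0 j) (Finset.mem_univ i)
  have hJJ : ∀ i j, Integrable (fun ω => J i ω * J j ω) P := fun i j => by
    refine .of_bound ((hJ.measurable i).mul (hJ.measurable j)).aestronglyMeasurable 1 ?_
    filter_upwards [hJ1] with ω hω
    rw [Real.norm_eq_abs, abs_mul]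
    exact mul_le_one₀ (hω i) (abs_nonneg _) (hω j)
  have hZZM : ∀ i j ω, |Z i ω * Z j ω| ≤ 4 * M ^ 2 := fun i j ω => by
    rw [abs_mul]
    calc _ ≤ (2 * M) * (2 * M) := mul_le_mul (hZM _ _) (hZM _ _) (abs_nonneg _)
          ((abs_nonneg _).trans (hZM i ω))
      _ = _ := by ring
  have hint : ∀ i j, Integrable (fun ω => (J i ω * J j ω) * (Z i ω * Z j ω)) P := fun i j =>
    (hJJ i j).mul_bdd (c := 4 * M ^ 2) ((hZm i).mul (hZm j)).aestronglyMeasurable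
      (ae_of_all _ fun ω => hZZM i j ω)
  have hfac : ∀ i j, ∫ ω, (J i ω * J j ω) * (Z i ω * Z j ω) ∂P
      = (∫ ω, J i ω * J j ω ∂P) * ∫ ω, Z i ω * Z j ω ∂P := by
    intro i j
    refine IndepFun.integral_fun_mul_eq_mul_integral ?_ (hJJ i j).1
      ((hZm i).mul (hZm j)).aestronglyMeasurable
    rw [IndepFun_iff_Indep]
    refine indep_of_indep_of_le_left (indep_of_indep_of_le_right hJ.indep ?_) ?_
    -- The centred variables involve the conditional mean as well as the sample, hence independence
    -- of the weights from the join of both σ-algebras.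
    · have hUc : Measurable[m ⊔ MeasurableSpace.comap (fun ω i => U i ω) inferInstance]
          fun ω i => U i ω := (comap_measurable _).mono le_sup_right le_rfl
      have hZ' : ∀ i, Measurable[m ⊔ MeasurableSpace.comap (fun ω i => U i ω) inferInstance]
          (Z i) := fun i =>
        (hf.comp ((measurable_pi_apply i).comp hUc)).sub (hκm.measurable.mono le_sup_left le_rfl)
      exact ((hZ' i).mul (hZ' j)).comap_le
    · have hJc : Measurable[MeasurableSpace.comap (fun ω i => J i ω) inferInstance]
          fun ω i => J i ω := comap_measurable _
      exact (((measurable_pi_apply i).comp hJc).mul ((measurable_pi_apply j).comp hJc)).comap_le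
  have hexp : ∀ ω, (∑ i, J i ω * (f (U i ω) - ∫ x, f x ∂κ ω)) ^ 2
      = ∑ i, ∑ j, (J i ω * J j ω) * (Z i ω * Z j ω) := by
    intro ω
    rw [sq, Finset.sum_mul_sum]
    exact Finset.sum_congr rfl fun i _ => Finset.sum_congr rfl fun j _ => by ring
  simp_rw [hexp]
  refine ⟨integrable_finsetSum _ fun i _ => integrable_finsetSum _ fun j _ => hint i j, ?_⟩
  rw [integral_finsetSum _ fun i _ => integrable_finsetSum _ fun j _ => hint i j, Finset.mul_sum]
  refine Finset.sum_le_sum fun i _ => ?_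
  rw [integral_finsetSum _ fun j _ => hint i j, Finset.sum_eq_single i _ (by simp), hfac, mul_comm]
  · have h1 : ∫ ω, Z i ω * Z i ω ∂P ≤ 4 * M ^ 2 :=
      (le_abs_self _).trans (abs_integral_le_of_abs_le fun ω => hZZM i i ω)
    have h2 : 0 ≤ ∫ ω, J i ω * J i ω ∂P := integral_nonneg fun ω => mul_self_nonneg _
    simp_rw [sq (J i _)]
    exact mul_le_mul_of_nonneg_right h1 h2
  · intro j _ hj
    rw [hfac, h.integral_centered_mul hj.symm hf hM, mul_zero]

/-- A weighted sample average is close in mean to the conditional expectation, by truncation of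
`f` to a bounded `g`. -/
theorem lintegral_weighted_sub_le (h : IsCondSample m P κ U) (hJ : IsIndepWeight m P U J)
    {f g : 𝔛 → ℝ} (hf : Measurable f) (hfi : Integrable f (P.bind κ)) (hg : Measurable g) {M : ℝ}
    (hM : ∀ x, |g x| ≤ M) {η : ℝ} (hη : 0 < η) :
    ∫⁻ ω, ‖∑ i, J i ω * f (U i ω) - ∫ x, f x ∂κ ω‖ₑ ∂P
      ≤ 2 * ∫⁻ x, ‖f x - g x‖ₑ ∂P.bind κ
        + ENNReal.ofReal (η + 4 * M ^ 2 / η * ∑ i, ∫ ω, J i ω ^ 2 ∂P) := by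
  set S : Ω → ℝ := fun ω => ∑ i, J i ω * (g (U i ω) - ∫ x, g x ∂κ ω) with hS
  have hd : Measurable fun x => ‖f x - g x‖ₑ := (hf.sub hg).enorm
  have hpt : ∀ᵐ ω ∂P, ‖∑ i, J i ω * f (U i ω) - ∫ x, f x ∂κ ω‖ₑ
      ≤ (∑ i, ‖J i ω‖ₑ * ‖f (U i ω) - g (U i ω)‖ₑ + ∫⁻ x, ‖f x - g x‖ₑ ∂κ ω)
        + ENNReal.ofReal (η + S ω ^ 2 / η) := by
    filter_upwards [Measure.ae_integrable_of_integrable_comp hfi, hJ.sum_eq_one] with ω hω h1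
    have hgω : Integrable g (κ ω) := integrable_of_abs_le hg hM
    -- Because the weights sum to `1`, the conditional mean of `g` can be moved inside the weighted
    -- sum.
    have e : ∑ i, J i ω * f (U i ω) - ∫ x, f x ∂κ ω
        = (∑ i, J i ω * (f (U i ω) - g (U i ω)) - ∫ x, (f x - g x) ∂κ ω) + S ω := by
      rw [integral_sub hω hgω]
      simp only [hS, mul_sub, Finset.sum_sub_distrib, ← Finset.sum_mul, h1]
      ring
    rw [e]
    refine (enorm_add_le _ _).trans (add_le_add ?_ ?_)
    · refine enorm_sub_le.trans (add_le_add ?_ (enorm_integral_le_lintegral_enorm _))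
      refine (enorm_sum_le _ _).trans_eq (Finset.sum_congr rfl fun i _ => enorm_mul _ _)
    · rw [Real.enorm_eq_ofReal_abs]
      exact ENNReal.ofReal_le_ofReal (abs_le_add_sq_div _ hη)
  obtain ⟨hSi, hSle⟩ := h.integral_sq_weighted_le hJ hg hM
  have hJe : ∀ i, Measurable fun ω => ‖J i ω‖ₑ := fun i => (hJ.measurable i).enorm
  have hdU : ∀ i, Measurable fun ω => ‖f (U i ω) - g (U i ω)‖ₑ := fun i =>
    hd.comp (h.measurable i)
  have hprod : ∀ i, Measurable fun ω => ‖J i ω‖ₑ * ‖f (U i ω) - g (U i ω)‖ₑ := fun i =>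
    (hJe i).mul (hdU i)
  have hκd : Measurable fun ω => ∫⁻ x, ‖f x - g x‖ₑ ∂κ ω := hd.lintegral_kernel
  -- Every `U i` has law `P.bind κ` and the expected weights add up to `1`, so the weighted
  -- truncation error costs as much as that of a single point.
  have hA : ∫⁻ ω, ∑ i, ‖J i ω‖ₑ * ‖f (U i ω) - g (U i ω)‖ₑ ∂P
      = ∫⁻ x, ‖f x - g x‖ₑ ∂P.bind κ := by
    have hfac : ∀ i, ∫⁻ ω, ‖J i ω‖ₑ * ‖f (U i ω) - g (U i ω)‖ₑ ∂P
        = (∫⁻ ω, ‖J i ω‖ₑ ∂P) * ∫⁻ x, ‖f x - g x‖ₑ ∂P.bind κ := by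
      intro i
      rw [← h.map_eq i, lintegral_map hd (h.measurable i)]
      refine lintegral_mul_eq_lintegral_mul_lintegral_of_indepFun (hJe i) (hdU i) ?_
      rw [IndepFun_iff_Indep]
      refine indep_of_indep_of_le_left (indep_of_indep_of_le_right hJ.indep ?_) ?_
      · refine le_trans ?_ le_sup_right
        exact (hd.comp ((measurable_pi_apply i).comp (comap_measurable fun ω i => U i ω))).comap_le
      · exact (measurable_enorm.comp ((measurable_pi_apply i).comp
          (comap_measurable fun ω i => J i ω))).comap_le
    rw [lintegral_finsetSum _ fun i _ => hprod i, Finset.sum_congr rfl fun i _ => hfac i,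
      ← Finset.sum_mul, ← lintegral_finsetSum _ fun i _ => hJe i]
    have : ∫⁻ ω, ∑ i, ‖J i ω‖ₑ ∂P = 1 := by
      rw [← measure_univ (μ := P), ← lintegral_one]
      refine lintegral_congr_ae ?_
      filter_upwards [hJ.nonneg, hJ.sum_eq_one] with ω h0 h1
      rw [Finset.sum_congr rfl fun i _ => Real.enorm_of_nonneg (h0 i),
        ← ENNReal.ofReal_sum_of_nonneg fun i _ => h0 i, h1, ENNReal.ofReal_one]
    rw [this, one_mul]
  have hC : ∫⁻ ω, ENNReal.ofReal (η + S ω ^ 2 / η) ∂P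
      ≤ ENNReal.ofReal (η + 4 * M ^ 2 / η * ∑ i, ∫ ω, J i ω ^ 2 ∂P) := by
    have hSη : Integrable (fun ω => S ω ^ 2 / η) P := hSi.div_const _
    have hSη' : Integrable (fun ω => η + S ω ^ 2 / η) P := (integrable_const _).add hSη
    have hpos : ∀ ω, 0 ≤ η + S ω ^ 2 / η := fun ω => by positivity
    rw [← ofReal_integral_eq_lintegral_ofReal hSη' (ae_of_all _ hpos),
      integral_add (integrable_const _) hSη, integral_div]
    refine ENNReal.ofReal_le_ofReal ?_
    simp only [integral_const, probReal_univ, smul_eq_mul, one_mul]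
    have := div_le_div_of_nonneg_right hSle hη.le
    rw [div_mul_eq_mul_div]
    linarith
  calc _ ≤ _ := lintegral_mono_ae hpt
    _ = _ := by
        have h1 : Measurable fun ω => ∑ i, ‖J i ω‖ₑ * ‖f (U i ω) - g (U i ω)‖ₑ :=
          Finset.measurable_fun_sum _ fun i _ => hprod i
        have h2 : Measurable fun ω => ∑ i, ‖J i ω‖ₑ * ‖f (U i ω) - g (U i ω)‖ₑ
            + ∫⁻ x, ‖f x - g x‖ₑ ∂κ ω := h1.add hκd
        rw [lintegral_add_left h2, lintegral_add_right _ hκd, hA, ← Measure.lintegral_bind κ.aemeasurable hd.aemeasurable,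
          ← two_mul]
    _ ≤ _ := by gcongr

end IsCondSample

theorem tendsto_zero_of_forall_ofReal {β : Type*} {l : Filter β} {u : β → ℝ≥0∞}
    (h : ∀ r : ℝ, 0 < r → ∀ᶠ p in l, u p ≤ ENNReal.ofReal r) : Tendsto u l (𝓝 0) := by
  refine ENNReal.tendsto_nhds_zero.2 fun ε hε => ?_
  obtain ⟨r, _, hr, hrε⟩ := ENNReal.lt_iff_exists_real_btwn.1 hε
  exact (h r (ENNReal.ofReal_pos.1 hr)).mono fun p hp => hp.trans hrε.le

/-- A weak law of large numbers in mean for weighted conditionally i.i.d. samples. -/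
theorem tendsto_lintegral_weighted_sub {Ω 𝔛 β : Type*} {mΩ : MeasurableSpace Ω}
    [MeasurableSpace 𝔛] {P : Measure Ω} [IsProbabilityMeasure P] {l : Filter β} {N : β → ℕ}
    {m : β → MeasurableSpace Ω} {κ : β → Kernel Ω 𝔛} {U : (p : β) → Fin (N p) → Ω → 𝔛}
    {J : (p : β) → Fin (N p) → Ω → ℝ} {μ : Measure 𝔛}
    (hU : ∀ᶠ p in l, IsMarkovKernel (κ p) ∧ IsCondSample (m p) P (κ p) (U p) ∧
      IsIndepWeight (m p) P (U p) (J p) ∧ P.bind (κ p) ≤ μ)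
    (hv : Tendsto (fun p => ∑ i, ∫ ω, J p i ω ^ 2 ∂P) l (𝓝 0))
    {f : 𝔛 → ℝ} (hf : Measurable f) (hfi : Integrable f μ) :
    Tendsto (fun p => ∫⁻ ω, ‖∑ i, J p i ω * f (U p i ω) - ∫ x, f x ∂κ p ω‖ₑ ∂P) l (𝓝 0) := by
  refine tendsto_zero_of_forall_ofReal fun r hr => ?_
  -- The simple function depends on `μ` and `r` alone, so it serves all indices `p`. The bound `r`
  -- is spent in quarters: truncation twice, `η`, and the variance term.
  obtain ⟨g, hg, -⟩ := (memLp_one_iff_integrable.2 hfi).exists_simpleFunc_eLpNorm_sub_lt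
    ENNReal.one_ne_top (ε := ENNReal.ofReal (r / 4)) (by simpa using hr)
  obtain ⟨M, hM⟩ := g.exists_forall_norm_le
  rw [eLpNorm_one_eq_lintegral_enorm] at hg
  have hlim : Tendsto (fun p => 4 * M ^ 2 / (r / 4) * ∑ i, ∫ ω, J p i ω ^ 2 ∂P) l (𝓝 0) := by
    simpa using hv.const_mul (4 * M ^ 2 / (r / 4))
  filter_upwards [hU, hlim.eventually_le_const (show 0 < r / 4 by positivity)]
    with p ⟨hκ, hUp, hJp, hle⟩ hp
  refine (hUp.lintegral_weighted_sub_le hJp hf (hfi.mono_measure hle) g.measurable hM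
    (show 0 < r / 4 by positivity)).trans ?_
  calc _ ≤ 2 * ENNReal.ofReal (r / 4) + ENNReal.ofReal (r / 4 + r / 4) := by
        gcongr
        exact (lintegral_mono' hle le_rfl).trans hg.le
    _ = ENNReal.ofReal r := by
        rw [two_mul, ← ENNReal.ofReal_add (by positivity) (by positivity),
          ← ENNReal.ofReal_add (by positivity) (by positivity)]
        congr 1; ring

/-! ### Modulus of continuity in the parameter, and finite nets. -/

theorem abs_sSup_image_sub_le {T : Type*} {Θ : Set T} (hne : Θ.Nonempty) {f g : T → ℝ}
    (hf : BddAbove (f '' Θ)) (hg : BddAbove (g '' Θ)) {r : ℝ} (h : ∀ θ ∈ Θ, |f θ - g θ| ≤ r) :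
    |sSup (f '' Θ) - sSup (g '' Θ)| ≤ r := by
  rw [abs_sub_le_iff]
  constructor
  · rw [sub_le_iff_le_add]
    refine csSup_le (hne.image f) ?_
    rintro _ ⟨θ, hθ, rfl⟩
    have h1 := (abs_sub_le_iff.1 (h θ hθ)).1
    have h2 := le_csSup hg ⟨θ, hθ, rfl⟩
    linarith
  · rw [sub_le_iff_le_add]
    refine csSup_le (hne.image g) ?_
    rintro _ ⟨θ, hθ, rfl⟩
    have h1 := (abs_sub_le_iff.1 (h θ hθ)).2
    have h2 := le_csSup hf ⟨θ, hθ, rfl⟩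
    linarith

/-- The modulus of continuity in `θ ∈ Θ` of the family `Dis`, at a point `x`. -/
noncomputable def modulus {S T : Type*} [PseudoMetricSpace T] (Θ : Set T) (Dis : T → S → ℝ) (δ : ℝ) (x : S) : ℝ :=
  sSup ((fun q : T × T => |Dis q.1 x - Dis q.2 x|) '' {q | q ∈ Θ ×ˢ Θ ∧ dist q.1 q.2 ≤ δ})

theorem envelope_nonneg {S T : Type*} {Θ : Set T} {Dis : T → S → ℝ} (x : S) : 0 ≤ envelope Θ Dis x :=
  Real.sSup_nonneg (by rintro _ ⟨θ, _, rfl⟩; exact abs_nonneg _)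

section Modulus

variable {S T : Type*} [PseudoMetricSpace T] {Θ : Set T} {Dis : T → S → ℝ}

theorem abs_sub_le_two_mul_envelope (hΘ : IsCompact Θ)
    (hcont : ∀ x, ContinuousOn (fun θ => Dis θ x) Θ) {θ θ' : T} (hθ : θ ∈ Θ) (hθ' : θ' ∈ Θ)
    (x : S) : |Dis θ x - Dis θ' x| ≤ 2 * envelope Θ Dis x := by
  have h1 := abs_le_envelope hΘ hcont hθ x
  have h2 := abs_le_envelope hΘ hcont hθ' x
  linarith [abs_sub (Dis θ x) (Dis θ' x)]

theorem abs_sub_le_modulus (hΘ : IsCompact Θ) (hcont : ∀ x, ContinuousOn (fun θ => Dis θ x) Θ)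
    {θ θ' : T} (hθ : θ ∈ Θ) (hθ' : θ' ∈ Θ) {δ : ℝ} (hd : dist θ θ' ≤ δ) (x : S) :
    |Dis θ x - Dis θ' x| ≤ modulus Θ Dis δ x := by
  refine le_csSup ⟨2 * envelope Θ Dis x, ?_⟩ ⟨(θ, θ'), ⟨⟨hθ, hθ'⟩, hd⟩, rfl⟩
  rintro _ ⟨q, hq, rfl⟩
  exact abs_sub_le_two_mul_envelope hΘ hcont hq.1.1 hq.1.2 x

theorem modulus_nonneg (δ : ℝ) (x : S) : 0 ≤ modulus Θ Dis δ x :=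
  Real.sSup_nonneg (by rintro _ ⟨θ, _, rfl⟩; exact abs_nonneg _)

theorem modulus_le_two_mul_envelope (hΘ : IsCompact Θ)
    (hcont : ∀ x, ContinuousOn (fun θ => Dis θ x) Θ) (δ : ℝ) (x : S) :
    modulus Θ Dis δ x ≤ 2 * envelope Θ Dis x := by
  refine Real.sSup_le ?_ (by linarith [envelope_nonneg (Θ := Θ) (Dis := Dis) x])
  rintro _ ⟨q, hq, rfl⟩
  exact abs_sub_le_two_mul_envelope hΘ hcont hq.1.1 hq.1.2 x

theorem tendsto_modulus (hΘ : IsCompact Θ) (hcont : ∀ x, ContinuousOn (fun θ => Dis θ x) Θ)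
    (x : S) : Tendsto (fun k : ℕ => modulus Θ Dis (1 / (k + 1)) x) atTop (𝓝 0) := by
  refine Metric.tendsto_atTop.2 fun ε hε => ?_
  obtain ⟨δ, hδ, h⟩ := Metric.uniformContinuousOn_iff.1
    (hΘ.uniformContinuousOn_of_continuous (hcont x)) (ε / 2) (by positivity)
  obtain ⟨k₀, hk₀⟩ := exists_nat_one_div_lt hδ
  refine ⟨k₀, fun k hk => ?_⟩
  rw [Real.dist_0_eq_abs, abs_of_nonneg (modulus_nonneg _ _)]
  refine lt_of_le_of_lt (Real.sSup_le ?_ (by positivity)) (half_lt_self hε)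
  rintro _ ⟨q, hq, rfl⟩
  exact (h _ hq.1.1 _ hq.1.2
    ((hq.2.trans (Nat.one_div_le_one_div hk)).trans_lt hk₀)).le

/-- A difference of two 1-Lipschitz functions is 2-Lipschitz, and so is a supremum of such
differences. This makes the supremum over uncountably many pairs measurable. -/
theorem continuous_modulus {𝔛 : Type*} [PseudoMetricSpace 𝔛] {Dis : T → 𝔛 → ℝ}
    (hΘ : IsCompact Θ) (hcont : ∀ x, ContinuousOn (fun θ => Dis θ x) Θ)
    (hLip : ∀ θ ∈ Θ, LipschitzWith 1 (Dis θ)) (δ : ℝ) : Continuous (modulus Θ Dis δ) := by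
  refine (LipschitzWith.of_le_add_mul 2 fun x y => ?_).continuous
  refine Real.sSup_le ?_ (add_nonneg (modulus_nonneg _ _) (by positivity))
  rintro _ ⟨q, hq, rfl⟩
  have h0 := abs_sub_le_modulus hΘ hcont hq.1.1 hq.1.2 hq.2 y
  have h1 := (hLip _ hq.1.1).dist_le_mul x y
  have h2 := (hLip _ hq.1.2).dist_le_mul x y
  rw [Real.dist_eq] at h1 h2
  simp only [NNReal.coe_one, one_mul, NNReal.coe_ofNat] at h1 h2 ⊢
  rw [abs_le] at h0 h1 h2 ⊢
  constructor <;> linarith [h0.1, h0.2, h1.1, h1.2, h2.1, h2.2]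

theorem exists_lintegral_modulus_le {𝔛 : Type*} [PseudoMetricSpace 𝔛] [MeasurableSpace 𝔛]
    [OpensMeasurableSpace 𝔛] {Dis : T → 𝔛 → ℝ} (hΘ : IsCompact Θ)
    (hcont : ∀ x, ContinuousOn (fun θ => Dis θ x) Θ)
    (hLip : ∀ θ ∈ Θ, LipschitzWith 1 (Dis θ)) {μ : Measure 𝔛}
    (hμ : Integrable (envelope Θ Dis) μ) {ε : ℝ≥0∞} (hε : 0 < ε) :
    ∃ δ > 0, ∫⁻ x, ‖modulus Θ Dis δ x‖ₑ ∂μ ≤ ε := by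
  have h := tendsto_lintegral_of_dominated_convergence'
    (F := fun (k : ℕ) x => ‖modulus Θ Dis (1 / (k + 1)) x‖ₑ) (f := fun _ => 0) (μ := μ)
    (fun x => ‖2 * envelope Θ Dis x‖ₑ)
    (fun k => (continuous_modulus hΘ hcont hLip _).measurable.enorm.aemeasurable)
    (fun k => ae_of_all _ fun x => by
      beta_reduce
      rw [Real.enorm_of_nonneg (modulus_nonneg _ _), Real.enorm_of_nonneg
        ((modulus_nonneg 0 _).trans (modulus_le_two_mul_envelope hΘ hcont 0 x))]
      exact ENNReal.ofReal_le_ofReal (modulus_le_two_mul_envelope hΘ hcont _ x))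
    (hμ.const_mul 2).2.ne
    (ae_of_all _ fun x => by simpa using (tendsto_modulus hΘ hcont x).enorm)
  rw [lintegral_zero] at h
  obtain ⟨k, hk⟩ := (ENNReal.tendsto_nhds_zero.1 h ε hε).exists
  exact ⟨_, Nat.one_div_pos_of_nat, hk⟩

/-- On a finite `δ`-net, the discrepancy of two measures on the whole family is controlled by that
on the net and on the modulus of continuity. -/
theorem abs_weighted_sub_integral_le {𝔛 : Type*} [MeasurableSpace 𝔛] {Dis : T → 𝔛 → ℝ}
    (hΘ : IsCompact Θ) (hcont : ∀ x, ContinuousOn (fun θ => Dis θ x) Θ)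
    (hmeas : ∀ θ ∈ Θ, Measurable (Dis θ)) {δ : ℝ} (hmod : Measurable (modulus Θ Dis δ))
    {ν : Measure 𝔛} (hν : Integrable (envelope Θ Dis) ν) {s : Finset T} (hs : ∀ θ ∈ s, θ ∈ Θ)
    (hcover : ∀ θ ∈ Θ, ∃ θ' ∈ s, dist θ θ' ≤ δ) {n : ℕ} {J : Fin n → ℝ} (hJ : ∀ i, 0 ≤ J i)
    (x : Fin n → 𝔛) {θ : T} (hθ : θ ∈ Θ) :
    |∑ i, J i * Dis θ (x i) - ∫ y, Dis θ y ∂ν|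
      ≤ ∑ θ' ∈ s, |∑ i, J i * Dis θ' (x i) - ∫ y, Dis θ' y ∂ν|
        + |∑ i, J i * modulus Θ Dis δ (x i) - ∫ y, modulus Θ Dis δ y ∂ν|
        + 2 * ∫ y, modulus Θ Dis δ y ∂ν := by
  obtain ⟨θ', hθs, hd⟩ := hcover θ hθ
  have hint : ∀ θ ∈ Θ, Integrable (Dis θ) ν := fun θ hθ =>
    hν.mono' (hmeas θ hθ).aestronglyMeasurable (ae_of_all _ fun y => abs_le_envelope hΘ hcont hθ y)
  have hmodi : Integrable (modulus Θ Dis δ) ν :=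
    (hν.const_mul 2).mono' hmod.aestronglyMeasurable (ae_of_all _ fun y => by
      rw [Real.norm_of_nonneg (modulus_nonneg _ _)]
      exact modulus_le_two_mul_envelope hΘ hcont _ y)
  have hw := abs_sub_le_modulus hΘ hcont hθ (hs _ hθs) hd
  have h1 : |∑ i, J i * Dis θ (x i) - ∑ i, J i * Dis θ' (x i)|
      ≤ ∑ i, J i * modulus Θ Dis δ (x i) := by
    rw [← Finset.sum_sub_distrib]
    refine (Finset.abs_sum_le_sum_abs _ _).trans (Finset.sum_le_sum fun i _ => ?_)
    rw [← mul_sub, abs_mul, abs_of_nonneg (hJ i)]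
    exact mul_le_mul_of_nonneg_left (hw _) (hJ i)
  have h2 : |∫ y, Dis θ y ∂ν - ∫ y, Dis θ' y ∂ν| ≤ ∫ y, modulus Θ Dis δ y ∂ν := by
    rw [← integral_sub (hint θ hθ) (hint θ' (hs _ hθs))]
    exact (abs_integral_le_integral_abs).trans (integral_mono
      ((hint θ hθ).sub (hint θ' (hs _ hθs))).abs hmodi hw)
  have h3 : |∑ i, J i * Dis θ' (x i) - ∫ y, Dis θ' y ∂ν|
      ≤ ∑ θ' ∈ s, |∑ i, J i * Dis θ' (x i) - ∫ y, Dis θ' y ∂ν| :=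
    Finset.single_le_sum (f := fun θ' => |∑ i, J i * Dis θ' (x i) - ∫ y, Dis θ' y ∂ν|)
      (fun _ _ => abs_nonneg _) hθs
  -- Replacing the weighted modulus by its integral produces the second copy of that integral; the
  -- first comes from moving `θ` to `θ'` under `ν`.
  have h4 := le_abs_self (∑ i, J i * modulus Θ Dis δ (x i) - ∫ y, modulus Θ Dis δ y ∂ν)
  rw [abs_le] at h1 h2 ⊢
  have h5 := abs_le.1 h3
  constructor <;> linarith [h1.1, h1.2, h2.1, h2.2, h5.1, h5.2]

end Modulus

/-! ### Uniform law over `Θ` and convergence of the estimator. -/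

section Uniform

variable {𝔛 Ω T β : Type*} [PseudoMetricSpace 𝔛] [MeasurableSpace 𝔛] [OpensMeasurableSpace 𝔛]
  {mΩ : MeasurableSpace Ω} {P : Measure Ω} [PseudoMetricSpace T]
  {Θ : Set T} {Dis : T → 𝔛 → ℝ} {l : Filter β} {N : β → ℕ}

/-- A uniform law of large numbers in mean over the family of discriminators, from the law for
single functions. -/
theorem eventually_exists_uniform_bound (hΘ : IsCompact Θ)
    (hcont : ∀ x, ContinuousOn (fun θ => Dis θ x) Θ) (hLip : ∀ θ ∈ Θ, LipschitzWith 1 (Dis θ))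
    {J : (p : β) → Fin (N p) → Ω → ℝ} {U : (p : β) → Fin (N p) → Ω → 𝔛} {κ : Kernel Ω 𝔛}
    [IsMarkovKernel κ] (hκ : Integrable (envelope Θ Dis) (P.bind κ))
    (hev : ∀ᶠ p in l, (∀ i, Measurable (J p i)) ∧ (∀ i, Measurable (U p i)) ∧
      ∀ᵐ ω ∂P, ∀ i, 0 ≤ J p i ω)
    (hlln : ∀ f : 𝔛 → ℝ, Measurable f → (∀ x, |f x| ≤ 2 * envelope Θ Dis x) →
      Tendsto (fun p => ∫⁻ ω, ‖∑ i, J p i ω * f (U p i ω) - ∫ x, f x ∂κ ω‖ₑ ∂P) l (𝓝 0))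
    {ε : ℝ≥0∞} (hε : 0 < ε) :
    ∀ᶠ p in l, ∃ R : Ω → ℝ≥0∞, Measurable R ∧ ∫⁻ ω, R ω ∂P ≤ ε ∧ ∀ᵐ ω ∂P, ∀ θ ∈ Θ,
      ‖∑ i, J p i ω * Dis θ (U p i ω) - ∫ x, Dis θ x ∂κ ω‖ₑ ≤ R ω := by
  have hmeas : ∀ θ ∈ Θ, Measurable (Dis θ) := fun θ hθ => (hLip θ hθ).continuous.measurable
  -- The mean modulus enters twice, hence `ε / 4`; the errors on the net take the other half. Both
  -- `δ` and the net are fixed before `p`.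
  obtain ⟨δ, hδ, hδε⟩ := exists_lintegral_modulus_le hΘ hcont hLip hκ
    (ε := ε / 4) (ENNReal.div_pos hε.ne' (by simp))
  have hmod : Measurable (modulus Θ Dis δ) := (continuous_modulus hΘ hcont hLip δ).measurable
  obtain ⟨s, hsΘ, hsfin, hscov⟩ := hΘ.finite_cover_balls hδ
  lift s to Finset T using hsfin
  have hs : ∀ θ ∈ s, θ ∈ Θ := fun θ hθ => hsΘ hθ
  have hcover : ∀ θ ∈ Θ, ∃ θ' ∈ s, dist θ θ' ≤ δ := fun θ hθ => by
    obtain ⟨θ', hθ', hd⟩ := Set.mem_iUnion₂.1 (hscov hθ)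
    exact ⟨θ', hθ', (Metric.mem_ball.1 hd).le⟩
  set D : (𝔛 → ℝ) → β → Ω → ℝ≥0∞ := fun f p ω =>
    ‖∑ i, J p i ω * f (U p i ω) - ∫ x, f x ∂κ ω‖ₑ with hD
  have hlim : Tendsto (fun p => ∑ θ ∈ s, ∫⁻ ω, D (Dis θ) p ω ∂P
      + ∫⁻ ω, D (modulus Θ Dis δ) p ω ∂P) l (𝓝 0) := by
    have h1 := tendsto_finsetSum s fun θ hθ => hlln (Dis θ) (hmeas θ (hs θ hθ)) fun x =>
      (abs_le_envelope hΘ hcont (hs θ hθ) x).trans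
        (by linarith [envelope_nonneg (Θ := Θ) (Dis := Dis) x])
    have h2 := hlln _ hmod fun x => by
      rw [abs_of_nonneg (modulus_nonneg _ _)]
      exact modulus_le_two_mul_envelope hΘ hcont _ x
    simpa using h1.add h2
  filter_upwards [hev, ENNReal.tendsto_nhds_zero.1 hlim (ε / 2) (ENNReal.div_pos hε.ne' (by simp))]
    with p ⟨hJm, hUm, hJ0⟩ hp
  have hDm : ∀ f : 𝔛 → ℝ, Measurable f → Measurable (D f p) := fun f hf => by
    refine Measurable.enorm (Measurable.sub ?_ hf.stronglyMeasurable.integral_kernel.measurable)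
    exact Finset.measurable_fun_sum _ fun i _ => (hJm i).mul (hf.comp (hUm i))
  have hκm : Measurable fun ω => ∫⁻ x, ‖modulus Θ Dis δ x‖ₑ ∂κ ω := hmod.enorm.lintegral_kernel
  have hsum : Measurable fun ω => ∑ θ ∈ s, D (Dis θ) p ω :=
    Finset.measurable_fun_sum _ fun θ hθ => hDm _ (hmeas θ (hs θ hθ))
  -- A measurable majorant made of finitely many terms stands in for the supremum of the errors over
  -- `Θ`.
  refine ⟨fun ω => (∑ θ ∈ s, D (Dis θ) p ω + D (modulus Θ Dis δ) p ω)
    + 2 * ∫⁻ x, ‖modulus Θ Dis δ x‖ₑ ∂κ ω, (hsum.add (hDm _ hmod)).add (hκm.const_mul 2), ?_, ?_⟩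
  · rw [lintegral_add_right _ (hκm.const_mul 2), lintegral_add_left hsum,
      lintegral_finsetSum _ fun θ hθ => hDm _ (hmeas θ (hs θ hθ)), lintegral_const_mul _ hκm,
      ← Measure.lintegral_bind κ.aemeasurable hmod.enorm.aemeasurable]
    calc _ ≤ ε / 2 + 2 * (ε / 4) := by gcongr
      _ = ε / 2 + ε / 2 := by
        congr 1
        rw [show (4 : ℝ≥0∞) = 2 * 2 by norm_num, ← mul_div_assoc,
          ENNReal.mul_div_mul_left _ _ (by simp) (by simp)]
      _ = ε := ENNReal.add_halves ε
  · filter_upwards [hJ0, Measure.ae_integrable_of_integrable_comp hκ] with ω h0 hi θ hθ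
    have key := abs_weighted_sub_integral_le hΘ hcont hmeas hmod hi hs hcover h0
      (fun i => U p i ω) hθ
    have hmodi : Integrable (modulus Θ Dis δ) (κ ω) :=
      (hi.const_mul 2).mono' hmod.aestronglyMeasurable (ae_of_all _ fun y => by
        rw [Real.norm_of_nonneg (modulus_nonneg _ _)]
        exact modulus_le_two_mul_envelope hΘ hcont _ y)
    have hw : ENNReal.ofReal (∫ y, modulus Θ Dis δ y ∂κ ω)
        = ∫⁻ x, ‖modulus Θ Dis δ x‖ₑ ∂κ ω := by
      rw [ofReal_integral_eq_lintegral_ofReal hmodi (ae_of_all _ fun y => modulus_nonneg _ _)]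
      exact lintegral_congr fun y => (Real.enorm_of_nonneg (modulus_nonneg _ _)).symm
    have hnn : 0 ≤ ∫ y, modulus Θ Dis δ y ∂κ ω := integral_nonneg fun y => modulus_nonneg _ _
    rw [Real.enorm_eq_ofReal_abs]
    refine (ENNReal.ofReal_le_ofReal key).trans_eq ?_
    rw [ENNReal.ofReal_add (by positivity) (by positivity), ENNReal.ofReal_add
      (Finset.sum_nonneg fun _ _ => abs_nonneg _) (abs_nonneg _),
      ENNReal.ofReal_sum_of_nonneg fun _ _ => abs_nonneg _, ENNReal.ofReal_mul (by norm_num), hw]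
    simp [hD, Real.enorm_eq_ofReal_abs]

theorem tendstoInMeasure_WHat [IsProbabilityMeasure P] (hΘ : IsCompact Θ) (hne : Θ.Nonempty)
    (hcont : ∀ x, ContinuousOn (fun θ => Dis θ x) Θ) (hLip : ∀ θ ∈ Θ, LipschitzWith 1 (Dis θ))
    {J : (p : β) → Fin (N p) → Ω → ℝ} {U Y : (p : β) → Fin (N p) → Ω → 𝔛} {κ : Kernel Ω 𝔛}
    [IsMarkovKernel κ] {G : Measure 𝔛} [IsProbabilityMeasure G]
    (hκ : Integrable (envelope Θ Dis) (P.bind κ)) (hG : Integrable (envelope Θ Dis) G)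
    (hev : ∀ᶠ p in l, (∀ i, Measurable (J p i)) ∧ (∀ i, Measurable (U p i)) ∧
      ∀ᵐ ω ∂P, ∀ i, 0 ≤ J p i ω)
    (hY : ∀ᶠ p in l, ∀ i, Measurable (Y p i))
    (hlln : ∀ f : 𝔛 → ℝ, Measurable f → (∀ x, |f x| ≤ 2 * envelope Θ Dis x) →
      Tendsto (fun p => ∫⁻ ω, ‖∑ i, J p i ω * f (U p i ω) - ∫ x, f x ∂κ ω‖ₑ ∂P) l (𝓝 0))
    (hllnY : ∀ f : 𝔛 → ℝ, Measurable f → (∀ x, |f x| ≤ 2 * envelope Θ Dis x) →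
      Tendsto (fun p => ∫⁻ ω, ‖∑ i, (N p : ℝ)⁻¹ * f (Y p i ω) - ∫ x, f x ∂G‖ₑ ∂P) l (𝓝 0)) :
    TendstoInMeasure P (fun p ω => WHat Θ Dis (fun i => J p i ω) (fun i => U p i ω)
      (fun i => Y p i ω)) l (fun ω => W Θ Dis (κ ω) G) := by
  have hmeas : ∀ θ ∈ Θ, Measurable (Dis θ) := fun θ hθ => (hLip θ hθ).continuous.measurable
  refine tendstoInMeasure_of_ne_top fun ε hε hεtop => ENNReal.tendsto_nhds_zero.2 fun δ hδ => ?_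
  -- Two errors of mean at most `ε * δ / 2` give probability at most `δ` after Markov's inequality
  -- at level `ε`.
  have hpos : 0 < ε * δ / 2 := ENNReal.div_pos (ENNReal.mul_pos hε.ne' hδ.ne').ne' (by simp)
  have hGb : P.bind (Kernel.const Ω G) = G := by simp
  have h1 := eventually_exists_uniform_bound hΘ hcont hLip hκ hev hlln hpos
  have h2 := eventually_exists_uniform_bound (J := fun p _ _ => (N p : ℝ)⁻¹) (U := Y)
    (κ := Kernel.const Ω G) hΘ hcont hLip (by rwa [hGb])
    (hY.mono fun p hp => ⟨fun _ => measurable_const, hp, ae_of_all _ fun _ _ => by positivity⟩)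
    (by simpa using hllnY) hpos
  filter_upwards [h1, h2] with p ⟨R₁, hR₁m, hR₁, hR₁le⟩ ⟨R₂, hR₂m, hR₂, hR₂le⟩
  calc P {ω | ε ≤ edist (WHat Θ Dis (fun i => J p i ω) (fun i => U p i ω) fun i => Y p i ω)
        (W Θ Dis (κ ω) G)} ≤ P {ω | ε ≤ R₁ ω + R₂ ω} := by
        refine measure_mono_ae ?_
        filter_upwards [hR₁le, hR₂le, Measure.ae_integrable_of_integrable_comp hκ]
          with ω hω₁ hω₂ hi (hω : ε ≤ _)
        refine (hω.trans ?_ : ε ≤ R₁ ω + R₂ ω)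
        rcases eq_or_ne (R₁ ω + R₂ ω) ∞ with htop | htop
        · simp [htop]
        rw [edist_dist, Real.dist_eq, ← ENNReal.ofReal_toReal htop]
        refine ENNReal.ofReal_le_ofReal (abs_sSup_image_sub_le hne
          (WHat_isGreatest hΘ hne hcont _ _ _).bddAbove
          (W_isGreatest hΘ hne hmeas hcont hi hG).bddAbove fun θ hθ => ?_)
        rw [← ENNReal.ofReal_le_iff_le_toReal htop, ← Real.enorm_eq_ofReal_abs]
        refine le_trans ?_ (add_le_add (hω₁ θ hθ) (hω₂ θ hθ))
        refine le_trans (le_of_eq ?_) enorm_sub_le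
        congr 1
        simp only [Kernel.const_apply, Finset.sum_sub_distrib, div_eq_inv_mul]
        ring
    _ ≤ (∫⁻ ω, (R₁ ω + R₂ ω) ∂P) / ε :=
        meas_ge_le_lintegral_div (hR₁m.add hR₂m).aemeasurable hε.ne' hεtop
    _ ≤ δ := by
        refine ENNReal.div_le_of_le_mul ?_
        rw [lintegral_add_left hR₁m]
        refine (add_le_add hR₁ hR₂).trans_eq ?_
        rw [ENNReal.add_halves, mul_comm]

end Uniform

/-! ### Dirichlet processes and samples as instances of the conditional framework. -/

variable {𝔛 Ω : Type*} [MeasurableSpace 𝔛] [MeasurableSpace Ω] {P : Measure Ω}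

/-- The base measure is the mean of a Dirichlet process. -/
theorem IsDirichletProcess.bind_eq {F : Kernel Ω 𝔛} [IsMarkovKernel F] {a : ℝ} (ha : 0 < a)
    {H : Measure 𝔛} [IsProbabilityMeasure H] (h : IsDirichletProcess P F a H) : P.bind F = H := by
  ext A hA
  -- The partition into `A` and its complement suffices: the first Dirichlet coordinate has mean `a
  -- * H(A) / a`.
  set B : Fin 2 → Set 𝔛 := ![A, Aᶜ] with hB
  have hBm : ∀ j, MeasurableSet (B j) := by
    simp [hB, Fin.forall_fin_two, hA, hA.compl]
  have hdisj : Pairwise fun i j => Disjoint (B i) (B j) := by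
    intro i j hij
    fin_cases i <;> fin_cases j <;>
      simp_all [disjoint_compl_right, disjoint_compl_left]
  have hunion : (⋃ j, B j) = Set.univ := by
    ext x; simp [hB, Fin.exists_fin_two, em]
  have hlaw := h.law_partition 2 le_rfl B hBm hdisj hunion
  have hnn : ∀ j, 0 ≤ a * H.real (B j) := fun j => by positivity
  have hsum : ∑ j, a * H.real (B j) = a := by
    rw [Fin.sum_univ_two, ← mul_add]
    simp [hB, probReal_add_probReal_compl hA]
  have hmeas : Measurable fun ω j => (F ω).real (B j) :=
    measurable_pi_lambda _ fun j => (F.measurable_coe (hBm j)).ennreal_toReal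
  have key := lintegral_dirichlet hnn (by rwa [hsum]) 0
  rw [← hlaw, lintegral_map (by fun_prop) hmeas, hsum, mul_div_cancel_left₀ _ ha.ne'] at key
  rw [Measure.bind_apply hA F.aemeasurable]
  simpa [hB] using key

theorem IsSampleFromRandom.isCondSample [IsProbabilityMeasure P] {F : Kernel Ω 𝔛}
    [IsMarkovKernel F] {X : ℕ → Ω → 𝔛} (h : IsSampleFromRandom P F X) (n : ℕ) :
    IsCondSample (MeasurableSpace.comap (fun ω => F ω) inferInstance) P F
      (fun i : Fin n => X i) :=
  .of_iInter F.measurable.comap_le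
    (fun _ hA => (Measure.measurable_coe hA).comp (comap_measurable _))
    (fun i => h.measurable i) (h.cond_law n)

theorem IsSampleFromRandom.map_eq [IsProbabilityMeasure P] {F : Kernel Ω 𝔛}
    [IsMarkovKernel F] {X : ℕ → Ω → 𝔛} (h : IsSampleFromRandom P F X) (i : ℕ) :
    P.map (X i) = P.bind F :=
  (h.isCondSample (i + 1)).map_eq (Fin.last i)

/-- An i.i.d. sample is a conditional sample given the trivial σ-algebra. The injection `e` picks
out finitely many members of an infinite sequence. -/
theorem IsIIDSample.condExp_bot [IsProbabilityMeasure P] {ι κ : Type*} [Fintype κ]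
    {G : Measure 𝔛} {Y : ι → Ω → 𝔛} (h : IsIIDSample P G Y) {e : κ → ι}
    (he : Function.Injective e) {A : κ → Set 𝔛} (hA : ∀ i, MeasurableSet (A i)) :
    P[(⋂ i, Y (e i) ⁻¹' A i).indicator (fun _ => (1 : ℝ)) | ⊥] = fun _ => ∏ i, G.real (A i) := by
  have hm : ∀ i, MeasurableSet (Y (e i) ⁻¹' A i) := fun i => h.measurable _ (hA i)
  have h1 := (h.indep.precomp he).measure_inter_preimage_eq_mul Finset.univ (sets := A)
    fun i _ => hA i
  rw [MeasureTheory.condExp_bot]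
  funext ω
  rw [integral_indicator_const _ (MeasurableSet.iInter hm)]
  simp only [Finset.mem_univ, Set.iInter_true] at h1
  rw [smul_eq_mul, mul_one, measureReal_def, h1, ENNReal.toReal_prod]
  refine Finset.prod_congr rfl fun i _ => ?_
  rw [← h.law (e i), map_measureReal_apply (h.measurable _) (hA i), measureReal_def]

theorem IsIIDSample.isSampleFromRandom [IsProbabilityMeasure P] {F : Measure 𝔛} {X : ℕ → Ω → 𝔛}
    (h : IsIIDSample P F X) : IsSampleFromRandom P (Kernel.const Ω F) X where
  measurable := h.measurable
  cond_law n A hA := by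
    have : MeasurableSpace.comap (fun ω => Kernel.const Ω F ω) inferInstance = ⊥ := by
      simp [MeasurableSpace.comap_const]
    rw [this, h.condExp_bot Fin.val_injective hA]
    simp

theorem IsIIDSample.isCondSample [IsProbabilityMeasure P] {ι : Type*} [Fintype ι]
    {G : Measure 𝔛} [IsProbabilityMeasure G] {Y : ι → Ω → 𝔛} (h : IsIIDSample P G Y) :
    IsCondSample ⊥ P (Kernel.const Ω G) Y :=
  .of_iInter bot_le (fun A _ => by simp) h.measurable fun A hA => by
    have := h.condExp_bot Function.injective_id hA
    simp only [id] at this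
    rw [this]
    simp

/-- Constant weights generate the trivial σ-algebra, so ordinary sample averages fall under the
weighted weak law. -/
theorem isIndepWeight_inv [IsProbabilityMeasure P] {m : MeasurableSpace Ω} (N : ℕ) (hN : N ≠ 0)
    (U : Fin N → Ω → 𝔛) : IsIndepWeight m P U fun _ _ => (N : ℝ)⁻¹ where
  measurable _ := measurable_const
  nonneg := ae_of_all _ fun _ _ => by positivity
  sum_eq_one := ae_of_all _ fun _ => by simp [hN]
  indep := by
    rw [MeasurableSpace.comap_const]
    exact indep_bot_left _

theorem tendsto_sum_integral_inv_sq [IsProbabilityMeasure P] {β : Type*} {l : Filter β} {N : β → ℕ}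
    (hN : Tendsto N l atTop) :
    Tendsto (fun p => ∑ _i : Fin (N p), ∫ _, ((N p : ℝ)⁻¹) ^ 2 ∂P) l (𝓝 0) := by
  refine ((tendsto_inv_atTop_nhds_zero_nat (𝕜 := ℝ)).comp hN).congr fun p => ?_
  rcases eq_or_ne (N p) 0 with h | h
  · simp [h]
  · simp
    field_simp

/-! ### The posterior base measure and the posterior weights. -/

section Posterior

variable {a : ℝ} {H : Measure 𝔛} {n : ℕ}

theorem posteriorBase_apply (x : Fin n → 𝔛) {A : Set 𝔛} (hA : MeasurableSet A) :
    posteriorBase a H x A = ENNReal.ofReal (a / (a + n)) * H A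
      + ENNReal.ofReal (n / (a + n)) * ((n : ℝ≥0∞)⁻¹ * ∑ i, A.indicator 1 (x i)) := by
  simp [posteriorBase, empirical, Measure.dirac_apply' _ hA]

theorem measurable_posteriorBase : Measurable fun x : Fin n → 𝔛 => posteriorBase a H x := by
  refine Measure.measurable_of_measurable_coe _ fun A hA => ?_
  simp_rw [posteriorBase_apply _ hA]
  have : Measurable fun x : Fin n → 𝔛 => ∑ i, A.indicator (1 : 𝔛 → ℝ≥0∞) (x i) :=
    Finset.measurable_fun_sum _ fun i _ =>
      (measurable_one.indicator hA).comp (measurable_pi_apply i)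
  fun_prop

theorem isProbabilityMeasure_posteriorBase [IsProbabilityMeasure H] (ha : 0 < a)
    (x : Fin n → 𝔛) : IsProbabilityMeasure (posteriorBase a H x) := by
  refine ⟨?_⟩
  rw [posteriorBase_apply _ .univ]
  rcases Nat.eq_zero_or_pos n with rfl | hn
  · simp [ha.ne']
  · have : (n : ℝ≥0∞)⁻¹ * n = 1 := ENNReal.inv_mul_cancel (by simpa using hn.ne') (by simp)
    simp only [measure_univ, mul_one, Set.indicator_univ, Pi.one_apply, Finset.sum_const,
      Finset.card_univ, Fintype.card_fin, nsmul_eq_mul, this]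
    rw [← ENNReal.ofReal_add (by positivity) (by positivity), ← add_div, div_self (by positivity),
      ENNReal.ofReal_one]

theorem integral_posteriorBase (ha : 0 < a) (x : Fin n → 𝔛) {f : 𝔛 → ℝ} (hf : Measurable f)
    (hfi : Integrable f H) : ∫ y, f y ∂posteriorBase a H x
      = a / (a + n) * ∫ y, f y ∂H + n / (a + n) * ∑ i, (n : ℝ)⁻¹ * f (x i) := by
  have hd : ∀ y, Integrable f (Measure.dirac y) := fun y =>
    integrable_dirac' hf.stronglyMeasurable (by simp)
  have hs : Integrable f (∑ i, Measure.dirac (x i)) :=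
    integrable_finsetSum_measure.2 fun i _ => hd _
  have he : Integrable f (empirical x) := by
    -- For `n = 0` the scalar in `empirical` is infinite, but it multiplies the zero measure.
    rcases Nat.eq_zero_or_pos n with rfl | hn
    · simp [empirical]
    · exact hs.smul_measure (by simpa using hn.ne')
  rw [posteriorBase, integral_add_measure (hfi.smul_measure ENNReal.ofReal_ne_top)
    (he.smul_measure ENNReal.ofReal_ne_top), integral_smul_measure, integral_smul_measure,
    empirical, integral_smul_measure, integral_finsetSum_measure fun i _ => hd _]
  simp_rw [integral_dirac' f _ hf.stronglyMeasurable]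
  rw [ENNReal.toReal_ofReal (by positivity), ENNReal.toReal_ofReal (by positivity)]
  simp [Finset.mul_sum]

open Classical in
/-- The posterior base measure as a random measure; `0` if the data are not measurable. -/
noncomputable def posteriorKernel (a : ℝ) (H : Measure 𝔛) (X : Fin n → Ω → 𝔛) : Kernel Ω 𝔛 :=
  if h : ∀ i, Measurable (X i) then
    ⟨fun ω => posteriorBase a H fun i => X i ω,
      measurable_posteriorBase.comp (measurable_pi_lambda _ h)⟩
  else 0

variable {X : Fin n → Ω → 𝔛}

theorem posteriorKernel_apply (hX : ∀ i, Measurable (X i)) (ω : Ω) :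
    posteriorKernel a H X ω = posteriorBase a H fun i => X i ω := by
  rw [posteriorKernel, dif_pos hX]; rfl

theorem isMarkovKernel_posteriorKernel [IsProbabilityMeasure H] (ha : 0 < a)
    (hX : ∀ i, Measurable (X i)) : IsMarkovKernel (posteriorKernel a H X) :=
  ⟨fun ω => by
    rw [posteriorKernel_apply hX]
    exact isProbabilityMeasure_posteriorBase ha _⟩

/-- Both mixture weights are at most `1` and each data point has law `Q`. The bound is free of `a`
and `n`, as a common truncation requires. -/
theorem bind_posteriorKernel_le [IsProbabilityMeasure P] (ha : 0 < a) (hX : ∀ i, Measurable (X i))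
    {Q : Measure 𝔛} (hQ : ∀ i, P.map (X i) = Q) : P.bind (posteriorKernel a H X) ≤ H + Q := by
  refine Measure.le_iff.2 fun A hA => ?_
  rw [Measure.bind_apply hA (Kernel.aemeasurable _)]
  simp_rw [posteriorKernel_apply hX, posteriorBase_apply _ hA]
  have hi : ∀ i, Measurable fun ω => A.indicator (1 : 𝔛 → ℝ≥0∞) (X i ω) := fun i =>
    (measurable_one.indicator hA).comp (hX i)
  have hi' : ∀ i, ∫⁻ ω, A.indicator (1 : 𝔛 → ℝ≥0∞) (X i ω) ∂P = Q A := fun i => by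
    rw [← hQ i, ← lintegral_map (measurable_one.indicator hA) (hX i), lintegral_indicator_one hA]
  have hsm : Measurable fun ω => ∑ i, A.indicator (1 : 𝔛 → ℝ≥0∞) (X i ω) :=
    Finset.measurable_fun_sum _ fun i _ => hi i
  rw [lintegral_add_left measurable_const, lintegral_const_mul _ (hsm.const_mul _), lintegral_const_mul _ hsm,
    lintegral_finsetSum _ fun i _ => hi i]
  simp only [hi', lintegral_const, measure_univ, mul_one, Finset.sum_const, Finset.card_univ,
    Fintype.card_fin, nsmul_eq_mul, Measure.coe_add, Pi.add_apply]
  rw [← mul_assoc (n : ℝ≥0∞)⁻¹]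
  have h1 : ENNReal.ofReal (a / (a + n)) ≤ 1 := ENNReal.ofReal_le_one.2
    (div_le_one_of_le₀ (by simp) (by positivity))
  have h2 : ENNReal.ofReal (n / (a + n)) ≤ 1 := ENNReal.ofReal_le_one.2
    (div_le_one_of_le₀ (by linarith) (by positivity))
  have h3 : (n : ℝ≥0∞)⁻¹ * n ≤ 1 := ENNReal.inv_mul_le_one _
  calc _ ≤ 1 * H A + 1 * (1 * Q A) := by gcongr
    _ = _ := by simp

variable {N : ℕ} {Xpos : Fin N → Ω → 𝔛} {J : Fin N → Ω → ℝ}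

theorem IsPosteriorApprox.isCondSample [IsProbabilityMeasure P] [IsProbabilityMeasure H]
    (h : IsPosteriorApprox P a H X Xpos J) (ha : 0 < a) (hX : ∀ i, Measurable (X i)) :
    IsCondSample (MeasurableSpace.comap (fun ω i => X i ω) inferInstance) P
      (posteriorKernel a H X) Xpos := by
  have := isMarkovKernel_posteriorKernel (H := H) ha hX
  refine .of_iInter (measurable_pi_lambda _ hX).comap_le (fun A hA => ?_) h.measurable_loc
    fun A hA => ?_
  · simp_rw [posteriorKernel_apply hX]
    exact ((Measure.measurable_coe hA).comp measurable_posteriorBase).comp (comap_measurable _)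
  · simp_rw [posteriorKernel_apply hX]
    exact h.cond_law A hA

theorem IsPosteriorApprox.isIndepWeight
    (h : IsPosteriorApprox P a H X Xpos J) (ha : 0 < a) (hN : N ≠ 0) :
    IsIndepWeight (MeasurableSpace.comap (fun ω i => X i ω) inferInstance) P Xpos J := by
  have hJ : Measurable fun ω i => J i ω := measurable_pi_lambda _ h.measurable_weight
  have hNp : 0 < (N : ℝ) := by positivity
  have hα : ∀ _i : Fin N, 0 ≤ (a + n) / N := fun _ => by positivity
  have hα' : (a + n) / N ≠ 0 := by positivity
  refine ⟨h.measurable_weight, ?_, ?_, ?_⟩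
  · have := ae_dirichlet_nonneg hα
    rw [← h.law_weight] at this
    exact ae_of_ae_map hJ.aemeasurable this
  · have := ae_dirichlet_sum_eq_one hα (i := ⟨0, Nat.pos_of_ne_zero hN⟩) hα'
    rw [← h.law_weight] at this
    exact ae_of_ae_map hJ.aemeasurable this
  · have := h.indep
    rw [IndepFun_iff_Indep] at this
    convert! this using 1
    exact (MeasurableSpace.comap_prodMk _ _).symm

/-- With `s = a + n` the sum equals `s / (s + 1) * (1 / N) + 1 / (s + 1)`: the first term reflects
the finite number of atoms, the second the spread of the Dirichlet process itself. -/
theorem IsPosteriorApprox.sum_integral_sq_le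
    (h : IsPosteriorApprox P a H X Xpos J) (ha : 0 < a) (hN : N ≠ 0) :
    ∑ i, ∫ ω, J i ω ^ 2 ∂P ≤ 1 / N + 1 / (a + n) := by
  have hJ : Measurable fun ω i => J i ω := measurable_pi_lambda _ h.measurable_weight
  have hNp : 0 < (N : ℝ) := by positivity
  have hα : ∀ _i : Fin N, 0 ≤ (a + n) / N := fun _ => by positivity
  have hsum : ∑ _i : Fin N, (a + n) / N = a + n := by simp; field_simp
  have hi : ∀ i, ∫ ω, J i ω ^ 2 ∂P
      = (a + n) / N * ((a + n) / N + 1) / ((a + n) * (a + n + 1)) := by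
    intro i
    have key := lintegral_sq_dirichlet hα (by rw [hsum]; positivity) i
    rw [← h.law_weight, lintegral_map (by fun_prop) hJ, hsum] at key
    rw [integral_eq_lintegral_of_nonneg_ae (ae_of_all _ fun ω => sq_nonneg _)
      ((h.measurable_weight i).pow_const 2).aestronglyMeasurable, key,
      ENNReal.toReal_ofReal (by positivity)]
  simp_rw [hi]
  have hap : 0 < a + n := by positivity
  have e : ∑ _i : Fin N, (a + n) / N * ((a + n) / N + 1) / ((a + n) * (a + n + 1))
      = (a + n) / (a + n + 1) * (1 / N) + 1 / (a + n + 1) := by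
    simp; field_simp
  rw [e]
  exact add_le_add
    (mul_le_of_le_one_left (by positivity) (div_le_one_of_le₀ (by linarith) (by linarith)))
    (one_div_le_one_div_of_le hap (by linarith))

end Posterior

/-! ### The two limiting regimes. -/

section Limit

variable {𝔛 Ω T : Type*} [PseudoMetricSpace 𝔛] [MeasurableSpace 𝔛] [OpensMeasurableSpace 𝔛]
  [MeasurableSpace Ω] {P : Measure Ω} [IsProbabilityMeasure P] [PseudoMetricSpace T]
  {Θ : Set T} {Dis : T → 𝔛 → ℝ} {H G : Measure 𝔛} [IsProbabilityMeasure H]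
  [IsProbabilityMeasure G]

theorem integrable_of_abs_le_envelope {T S : Type*} [MeasurableSpace S] {Θ : Set T}
    {Dis : T → S → ℝ} {μ : Measure S} (hμ : Integrable (envelope Θ Dis) μ) {f : S → ℝ}
    (hf : Measurable f) (hfe : ∀ x, |f x| ≤ 2 * envelope Θ Dis x) : Integrable f μ :=
  (hμ.const_mul 2).mono' hf.aestronglyMeasurable (ae_of_all _ hfe)

/-- The estimator converges as soon as the total mass `a + n` and the number of atoms `N` tend to
infinity and the posterior base measure converges in mean on single functions. -/
theorem tendstoInMeasure_posterior (hΘ : IsCompact Θ) (hne : Θ.Nonempty)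
    (hcont : ∀ x, ContinuousOn (fun θ => Dis θ x) Θ) (hLip : ∀ θ ∈ Θ, LipschitzWith 1 (Dis θ))
    {β : Type*} {l : Filter β} {a : β → ℝ} {n N : β → ℕ}
    {X : (p : β) → Fin (n p) → Ω → 𝔛} {Xpos Y : (p : β) → Fin (N p) → Ω → 𝔛}
    {J : (p : β) → Fin (N p) → Ω → ℝ} {κ : Kernel Ω 𝔛} [IsMarkovKernel κ] {Q : Measure 𝔛}
    (hH : Integrable (envelope Θ Dis) H) (hQ : Integrable (envelope Θ Dis) Q)
    (hG : Integrable (envelope Θ Dis) G) (hκ : Integrable (envelope Θ Dis) (P.bind κ))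
    (hN : Tendsto N l atTop) (han : Tendsto (fun p => a p + n p) l atTop)
    (hev : ∀ᶠ p in l, 0 < a p ∧ (∀ i, Measurable (X p i)) ∧ (∀ i, P.map (X p i) = Q) ∧
      IsPosteriorApprox P (a p) H (X p) (Xpos p) (J p) ∧ IsIIDSample P G (Y p))
    (hbase : ∀ f : 𝔛 → ℝ, Measurable f → (∀ x, |f x| ≤ 2 * envelope Θ Dis x) →
      Tendsto (fun p => ∫⁻ ω, ‖∫ x, f x ∂posteriorBase (a p) H (fun i => X p i ω)
        - ∫ x, f x ∂κ ω‖ₑ ∂P) l (𝓝 0)) :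
    TendstoInMeasure P (fun p ω => WHat Θ Dis (fun i => J p i ω) (fun i => Xpos p i ω)
      (fun i => Y p i ω)) l (fun ω => W Θ Dis (κ ω) G) := by
  have hN0 : ∀ᶠ p in l, N p ≠ 0 := (hN.eventually_gt_atTop 0).mono fun p hp => hp.ne'
  have hv : Tendsto (fun p => ∑ i, ∫ ω, J p i ω ^ 2 ∂P) l (𝓝 0) := by
    have h0 : Tendsto (fun p => 1 / (N p : ℝ) + 1 / (a p + n p)) l (𝓝 0) := by
      have h1 := (tendsto_inv_atTop_nhds_zero_nat (𝕜 := ℝ)).comp hN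
      have h2 := tendsto_inv_atTop_zero.comp han
      simpa using h1.add h2
    refine tendsto_of_tendsto_of_tendsto_of_le_of_le' tendsto_const_nhds h0
      (Eventually.of_forall fun p => Finset.sum_nonneg fun i _ => integral_nonneg fun ω =>
        sq_nonneg _) ?_
    filter_upwards [hN0, hev] with p hp h
    exact h.2.2.2.1.sum_integral_sq_le h.1 hp
  refine tendstoInMeasure_WHat hΘ hne hcont hLip hκ hG ?_
    (hev.mono fun p h => h.2.2.2.2.measurable) (fun f hf hfe => ?_) fun f hf hfe => ?_
  · filter_upwards [hN0, hev] with p hp ⟨ha, _, _, h, _⟩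
    exact ⟨h.measurable_weight, h.measurable_loc, (h.isIndepWeight ha hp).nonneg⟩
  · have h1 := tendsto_lintegral_weighted_sub (P := P) (l := l)
      (m := fun p => MeasurableSpace.comap (fun ω i => X p i ω) inferInstance)
      (κ := fun p => posteriorKernel (a p) H (X p)) (U := Xpos) (J := J) (μ := H + Q) (by
        filter_upwards [hN0, hev] with p hp ⟨ha, hX, hXQ, h, _⟩
        exact ⟨isMarkovKernel_posteriorKernel ha hX, h.isCondSample ha hX, h.isIndepWeight ha hp,
          bind_posteriorKernel_le ha hX hXQ⟩) hv hf
      ((integrable_of_abs_le_envelope hH hf hfe).add_measure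
        (integrable_of_abs_le_envelope hQ hf hfe))
    -- Triangle inequality through the integral against the posterior base measure.
    have h2 := h1.add (hbase f hf hfe)
    rw [add_zero] at h2
    refine tendsto_of_tendsto_of_tendsto_of_le_of_le' tendsto_const_nhds h2
      (Eventually.of_forall fun p => zero_le) ?_
    filter_upwards [hev] with p ⟨ha, hX, _, h, _⟩
    have hk : Measurable fun ω => ∫ x, f x ∂posteriorKernel (a p) H (X p) ω :=
      hf.stronglyMeasurable.integral_kernel.measurable
    have hs : Measurable fun ω => ∑ i, J p i ω * f (Xpos p i ω) :=
      Finset.measurable_fun_sum _ fun i _ =>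
        (h.measurable_weight i).mul (hf.comp (h.measurable_loc i))
    have hd : Measurable fun ω => ‖∑ i, J p i ω * f (Xpos p i ω)
        - ∫ x, f x ∂posteriorKernel (a p) H (X p) ω‖ₑ := (hs.sub hk).enorm
    rw [← lintegral_add_left hd]
    refine lintegral_mono fun ω => ?_
    rw [posteriorKernel_apply hX]
    refine le_trans (le_of_eq ?_) (enorm_add_le _ _)
    rw [sub_add_sub_cancel]
  · have h1 := tendsto_lintegral_weighted_sub (P := P) (l := l) (m := fun _ => ⊥)
      (κ := fun _ => Kernel.const Ω G) (U := Y) (J := fun p _ _ => (N p : ℝ)⁻¹) (μ := G) (by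
        filter_upwards [hN0, hev] with p hp ⟨_, _, _, _, h⟩
        exact ⟨inferInstance, h.isCondSample, isIndepWeight_inv _ hp _, by simp⟩)
      (tendsto_sum_integral_inv_sq hN) hf (integrable_of_abs_le_envelope hG hf hfe)
    simpa using h1

/-- The limit as the number `n` of data points tends to infinity. -/
theorem tendstoInMeasure_posterior_data (hΘ : IsCompact Θ) (hne : Θ.Nonempty)
    (hcont : ∀ x, ContinuousOn (fun θ => Dis θ x) Θ) (hLip : ∀ θ ∈ Θ, LipschitzWith 1 (Dis θ))
    (hH : Integrable (envelope Θ Dis) H) (hG : Integrable (envelope Θ Dis) G)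
    {F : Kernel Ω 𝔛} [IsMarkovKernel F] (hF : Integrable (envelope Θ Dis) (P.bind F))
    {a : ℝ} (ha : 0 < a) {X : ℕ → Ω → 𝔛} (hX : IsSampleFromRandom P F X)
    {Xpos Y : (n N : ℕ) → Fin N → Ω → 𝔛} {J : (n N : ℕ) → Fin N → Ω → ℝ}
    (hJ : ∀ n N, IsPosteriorApprox P a H (fun i : Fin n => X i) (Xpos n N) (J n N))
    (hY : ∀ n N, IsIIDSample P G (Y n N)) :
    TendstoInMeasure P (fun (p : ℕ × ℕ) ω => WHat Θ Dis (fun i => J p.1 p.2 i ω)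
      (fun i => Xpos p.1 p.2 i ω) (fun i => Y p.1 p.2 i ω))
      (atTop ×ˢ atTop) (fun ω => W Θ Dis (F ω) G) := by
  have hn : Tendsto (fun p : ℕ × ℕ => a + p.1) (atTop ×ˢ atTop) atTop :=
    tendsto_atTop_add_const_left _ _ (tendsto_natCast_atTop_atTop.comp tendsto_fst)
  refine tendstoInMeasure_posterior (a := fun _ => a) (n := Prod.fst) (N := Prod.snd)
    (X := fun p i => X i) (Xpos := fun p => Xpos p.1 p.2) (J := fun p => J p.1 p.2)
    (Y := fun p => Y p.1 p.2) hΘ hne hcont hLip hH hF hG hF tendsto_snd hn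
    (Eventually.of_forall fun p => ⟨ha, fun i => hX.measurable i, fun i => hX.map_eq i,
      hJ p.1 p.2, hY p.1 p.2⟩) fun f hf hfe => ?_
  have hfH := integrable_of_abs_le_envelope hH hf hfe
  have hfF := integrable_of_abs_le_envelope hF hf hfe
  -- The same weak law, now for the data given `F`, with weights `1 / n`.
  have h1 := tendsto_lintegral_weighted_sub (P := P) (l := atTop)
    (m := fun _ : ℕ => MeasurableSpace.comap (fun ω => F ω) inferInstance)
    (κ := fun _ => F) (U := fun n (i : Fin n) => X i) (J := fun n _ _ => (n : ℝ)⁻¹)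
    (μ := P.bind F) (by
      filter_upwards [eventually_ne_atTop 0] with n hn
      exact ⟨inferInstance, hX.isCondSample n, isIndepWeight_inv _ hn _, le_rfl⟩)
    (tendsto_sum_integral_inv_sq tendsto_id) hf hfF
  have h2 : Tendsto (fun p : ℕ × ℕ => ENNReal.ofReal (a / (a + p.1)) *
      (‖∫ x, f x ∂H‖ₑ + ∫⁻ x, ‖f x‖ₑ ∂P.bind F)) (atTop ×ˢ atTop) (𝓝 0) := by
    have h3 := ENNReal.tendsto_ofReal (hn.const_div_atTop a)
    have h4 := ENNReal.Tendsto.mul_const (b := ‖∫ x, f x ∂H‖ₑ + ∫⁻ x, ‖f x‖ₑ ∂P.bind F) h3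
      (Or.inr (ENNReal.add_ne_top.2 ⟨enorm_ne_top, hfF.2.ne⟩))
    simpa using h4
  have h5 := h2.add (h1.comp (tendsto_fst (f := atTop) (g := (atTop : Filter ℕ))))
  rw [add_zero] at h5
  refine tendsto_of_tendsto_of_tendsto_of_le_of_le tendsto_const_nhds h5 (fun p => zero_le) ?_
  rintro ⟨n, N⟩
  have hκm : Measurable fun ω => ∫⁻ x, ‖f x‖ₑ ∂F ω := hf.enorm.lintegral_kernel
  have e : ∫⁻ ω, ENNReal.ofReal (a / (a + n)) * (‖∫ x, f x ∂H‖ₑ + ∫⁻ x, ‖f x‖ₑ ∂F ω) ∂P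
      = ENNReal.ofReal (a / (a + n)) * (‖∫ x, f x ∂H‖ₑ + ∫⁻ x, ‖f x‖ₑ ∂P.bind F) := by
    rw [lintegral_const_mul _ (hκm.const_add _), lintegral_add_left measurable_const,
      Measure.lintegral_bind F.aemeasurable hf.enorm.aemeasurable]
    simp
  simp only [Function.comp_apply]
  rw [← e, ← lintegral_add_left ((hκm.const_add _).const_mul _)]
  refine lintegral_mono fun ω => ?_
  rw [integral_posteriorBase ha _ hf hfH]
  have han : a + n ≠ 0 := by positivity
  -- The mixture weights sum to `1`, so the error splits into a prior part, whose weight vanishes,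
  -- and the error of the data average.
  have e2 : a / (a + n) * ∫ y, f y ∂H + n / (a + n) * ∑ i : Fin n, (n : ℝ)⁻¹ * f (X i ω)
        - ∫ x, f x ∂F ω
      = a / (a + n) * (∫ y, f y ∂H - ∫ x, f x ∂F ω)
        + n / (a + n) * (∑ i : Fin n, (n : ℝ)⁻¹ * f (X i ω) - ∫ x, f x ∂F ω) := by
    field_simp; ring
  rw [e2]
  refine (enorm_add_le _ _).trans (add_le_add ?_ ?_)
  · rw [enorm_mul, Real.enorm_of_nonneg (by positivity)]
    gcongr
    exact enorm_sub_le.trans (add_le_add le_rfl (enorm_integral_le_lintegral_enorm _))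
  · rw [enorm_mul, Real.enorm_of_nonneg (by positivity)]
    exact mul_le_of_le_one_left zero_le (ENNReal.ofReal_le_one.2
      (div_le_one_of_le₀ (by linarith) (by positivity)))

/-- The limit as the mass `a` of the prior tends to infinity. -/
theorem tendstoInMeasure_posterior_mass (hΘ : IsCompact Θ) (hne : Θ.Nonempty)
    (hcont : ∀ x, ContinuousOn (fun θ => Dis θ x) Θ) (hLip : ∀ θ ∈ Θ, LipschitzWith 1 (Dis θ))
    (hH : Integrable (envelope Θ Dis) H) (hG : Integrable (envelope Θ Dis) G)
    {Q : Measure 𝔛} (hQ : Integrable (envelope Θ Dis) Q) (n : ℕ) {X : ℝ → ℕ → Ω → 𝔛}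
    (hXm : ∀ a, 0 < a → ∀ i, Measurable (X a i)) (hXQ : ∀ a, 0 < a → ∀ i, P.map (X a i) = Q)
    {Xpos Y : (a : ℝ) → (N : ℕ) → Fin N → Ω → 𝔛} {J : (a : ℝ) → (N : ℕ) → Fin N → Ω → ℝ}
    (hJ : ∀ a, 0 < a → ∀ N,
      IsPosteriorApprox P a H (fun i : Fin n => X a i) (Xpos a N) (J a N))
    (hY : ∀ a, 0 < a → ∀ N, IsIIDSample P G (Y a N)) :
    TendstoInMeasure P (fun (p : ℝ × ℕ) ω => WHat Θ Dis (fun i => J p.1 p.2 i ω)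
      (fun i => Xpos p.1 p.2 i ω) (fun i => Y p.1 p.2 i ω))
      (atTop ×ˢ atTop) (fun _ => W Θ Dis H G) := by
  have ha : Tendsto (fun p : ℝ × ℕ => p.1 + n) (atTop ×ˢ atTop) atTop :=
    tendsto_atTop_add_const_right _ _ tendsto_fst
  have hpos : ∀ᶠ p : ℝ × ℕ in atTop ×ˢ atTop, 0 < p.1 :=
    tendsto_fst.eventually (eventually_gt_atTop 0)
  have hb : P.bind (Kernel.const Ω H) = H := by simp
  refine tendstoInMeasure_posterior (a := Prod.fst) (n := fun _ => n) (N := Prod.snd)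
    (X := fun p i => X p.1 i) (Xpos := fun p => Xpos p.1 p.2) (J := fun p => J p.1 p.2)
    (Y := fun p => Y p.1 p.2) (κ := Kernel.const Ω H) hΘ hne hcont hLip hH hQ hG (by rwa [hb])
    tendsto_snd ha (hpos.mono fun p hp => ⟨hp, fun i => hXm _ hp i, fun i => hXQ _ hp i,
      hJ _ hp p.2, hY _ hp p.2⟩) fun f hf hfe => ?_
  have hfH := integrable_of_abs_le_envelope hH hf hfe
  have hfQ := integrable_of_abs_le_envelope hQ hf hfe
  -- Bounds the mean distance between the data average and the prior mean, uniformly in `a`, since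
  -- the law `Q` of a data point does not vary with `a`.
  set C : ℝ≥0∞ := n * (‖(n : ℝ)⁻¹‖ₑ * ∫⁻ x, ‖f x‖ₑ ∂Q) + ‖∫ x, f x ∂H‖ₑ with hC
  have hCtop : C ≠ ∞ := ENNReal.add_ne_top.2
    ⟨ENNReal.mul_ne_top (by simp) (ENNReal.mul_ne_top enorm_ne_top hfQ.2.ne), enorm_ne_top⟩
  have h2 : Tendsto (fun p : ℝ × ℕ => ENNReal.ofReal (n / (p.1 + n)) * C)
      (atTop ×ˢ atTop) (𝓝 0) := by
    have h4 := ENNReal.Tendsto.mul_const (b := C)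
      (ENNReal.tendsto_ofReal (ha.const_div_atTop (n : ℝ))) (Or.inr hCtop)
    simpa using h4
  refine tendsto_of_tendsto_of_tendsto_of_le_of_le' tendsto_const_nhds h2
    (Eventually.of_forall fun p => zero_le) ?_
  filter_upwards [hpos] with ⟨a, N⟩ (ha0 : 0 < a)
  have hXe : ∀ i, Measurable fun ω => ‖f (X a i ω)‖ₑ := fun i => (hf.comp (hXm a ha0 i)).enorm
  have hs : Measurable fun ω => ∑ i : Fin n, ‖(n : ℝ)⁻¹‖ₑ * ‖f (X a i ω)‖ₑ :=
    Finset.measurable_fun_sum _ fun i _ => (hXe i).const_mul _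
  have hXi : ∀ i, ∫⁻ ω, ‖f (X a i ω)‖ₑ ∂P = ∫⁻ x, ‖f x‖ₑ ∂Q := fun i => by
    rw [← hXQ a ha0 i, lintegral_map hf.enorm (hXm a ha0 i)]
  have e : ∫⁻ ω, ENNReal.ofReal (n / (a + n)) *
      (∑ i : Fin n, ‖(n : ℝ)⁻¹‖ₑ * ‖f (X a i ω)‖ₑ + ‖∫ x, f x ∂H‖ₑ) ∂P
      = ENNReal.ofReal (n / (a + n)) * C := by
    rw [lintegral_const_mul _ (hs.add_const _), lintegral_add_right _ measurable_const,
      lintegral_finsetSum Finset.univ fun (i : Fin n) _ => (hXe i).const_mul ‖(n : ℝ)⁻¹‖ₑ]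
    simp_rw [lintegral_const_mul _ (hXe _), hXi]
    simp [hC]
  rw [← e]
  refine lintegral_mono fun ω => ?_
  rw [integral_posteriorBase ha0 _ hf hfH, Kernel.const_apply]
  -- From `a / (a + n) - 1 = -(n / (a + n))`, the whole difference carries the vanishing factor.
  have e2 : a / (a + n) * ∫ y, f y ∂H + n / (a + n) * ∑ i : Fin n, (n : ℝ)⁻¹ * f (X a i ω)
        - ∫ x, f x ∂H
      = n / (a + n) * (∑ i : Fin n, (n : ℝ)⁻¹ * f (X a i ω) - ∫ x, f x ∂H) := by
    have han : a + n ≠ 0 := by positivity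
    field_simp; ring
  rw [e2, enorm_mul, Real.enorm_of_nonneg (by positivity)]
  gcongr
  refine enorm_sub_le.trans (add_le_add ((enorm_sum_le _ _).trans_eq ?_) le_rfl)
  exact Finset.sum_congr rfl fun i _ => enorm_mul _ _

end Limit

end BNPL

/-! ### The four limits. -/

theorem mainTheorem1
    {𝔛 : Type*} [MetricSpace 𝔛] [SecondCountableTopology 𝔛] [MeasurableSpace 𝔛] [BorelSpace 𝔛]
    {Ω : Type*} [MeasurableSpace Ω] (P : Measure Ω) [IsProbabilityMeasure P]
    -- a compact family of 1-Lipschitz discriminators, continuous in the parameter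
    {t : ℕ} (Θ : Set (EuclideanSpace ℝ (Fin t))) (hΘ : IsCompact Θ) (hΘne : Θ.Nonempty)
    (Dis : EuclideanSpace ℝ (Fin t) → 𝔛 → ℝ)
    (hLip : ∀ θ ∈ Θ, LipschitzWith 1 (Dis θ))
    (hcont : ∀ x, ContinuousOn (fun θ => Dis θ x) Θ)
    -- the base measure and the fixed distribution
    (H G : Measure 𝔛) [IsProbabilityMeasure H] [IsProbabilityMeasure G]
    (hH : Integrable (BNPL.envelope Θ Dis) H) (hG : Integrable (BNPL.envelope Θ Dis) G) :
    -- (A) the data distribution is random with a Dirichlet process prior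
    ( -- (i) `N, n → ∞`
      (∀ (a : ℝ), 0 < a →
        ∀ (F : Kernel Ω 𝔛) [IsMarkovKernel F] (X : ℕ → Ω → 𝔛)
          (Xpos : (n N : ℕ) → Fin N → Ω → 𝔛) (J : (n N : ℕ) → Fin N → Ω → ℝ)
          (Y : (n N : ℕ) → Fin N → Ω → 𝔛),
          BNPL.IsDirichletProcess P F a H →
          BNPL.IsSampleFromRandom P F X →
          (∀ n N, BNPL.IsPosteriorApprox P a H (fun i : Fin n => X i) (Xpos n N) (J n N)) →
          (∀ n N, BNPL.IsIIDSample P G (Y n N)) →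
          (∀ᵐ ω ∂P, Integrable (BNPL.envelope Θ Dis) (F ω)) ∧
          TendstoInMeasure P
            (fun (p : ℕ × ℕ) ω => BNPL.WHat Θ Dis (fun i => J p.1 p.2 i ω)
              (fun i => Xpos p.1 p.2 i ω) (fun i => Y p.1 p.2 i ω))
            (atTop ×ˢ atTop) (fun ω => BNPL.W Θ Dis (F ω) G)) ∧
      -- (ii) `N, a → ∞`
      (∀ (n : ℕ) (F : ℝ → Kernel Ω 𝔛) [∀ a, IsMarkovKernel (F a)] (X : ℝ → ℕ → Ω → 𝔛)
          (Xpos : (a : ℝ) → (N : ℕ) → Fin N → Ω → 𝔛) (J : (a : ℝ) → (N : ℕ) → Fin N → Ω → ℝ)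
          (Y : (a : ℝ) → (N : ℕ) → Fin N → Ω → 𝔛),
          (∀ a, 0 < a → BNPL.IsDirichletProcess P (F a) a H) →
          (∀ a, 0 < a → BNPL.IsSampleFromRandom P (F a) (X a)) →
          (∀ a, 0 < a → ∀ N,
            BNPL.IsPosteriorApprox P a H (fun i : Fin n => X a i) (Xpos a N) (J a N)) →
          (∀ a, 0 < a → ∀ N, BNPL.IsIIDSample P G (Y a N)) →
          TendstoInMeasure P
            (fun (p : ℝ × ℕ) ω => BNPL.WHat Θ Dis (fun i => J p.1 p.2 i ω)
              (fun i => Xpos p.1 p.2 i ω) (fun i => Y p.1 p.2 i ω))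
            (atTop ×ˢ atTop) (fun _ => BNPL.W Θ Dis H G)) ) ∧
    -- (B) the data are an i.i.d. sample from a fixed distribution `F`
    (∀ (F : Measure 𝔛) [IsProbabilityMeasure F], Integrable (BNPL.envelope Θ Dis) F →
      ∀ (X : ℕ → Ω → 𝔛), BNPL.IsIIDSample P F X →
      -- (i) `N, n → ∞`
      (∀ (a : ℝ), 0 < a →
        ∀ (Xpos : (n N : ℕ) → Fin N → Ω → 𝔛) (J : (n N : ℕ) → Fin N → Ω → ℝ)
          (Y : (n N : ℕ) → Fin N → Ω → 𝔛),
          (∀ n N, BNPL.IsPosteriorApprox P a H (fun i : Fin n => X i) (Xpos n N) (J n N)) →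
          (∀ n N, BNPL.IsIIDSample P G (Y n N)) →
          TendstoInMeasure P
            (fun (p : ℕ × ℕ) ω => BNPL.WHat Θ Dis (fun i => J p.1 p.2 i ω)
              (fun i => Xpos p.1 p.2 i ω) (fun i => Y p.1 p.2 i ω))
            (atTop ×ˢ atTop) (fun _ => BNPL.W Θ Dis F G)) ∧
      -- (ii) `N, a → ∞`
      (∀ (n : ℕ) (Xpos : (a : ℝ) → (N : ℕ) → Fin N → Ω → 𝔛)
          (J : (a : ℝ) → (N : ℕ) → Fin N → Ω → ℝ) (Y : (a : ℝ) → (N : ℕ) → Fin N → Ω → 𝔛),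
          (∀ a, 0 < a → ∀ N,
            BNPL.IsPosteriorApprox P a H (fun i : Fin n => X i) (Xpos a N) (J a N)) →
          (∀ a, 0 < a → ∀ N, BNPL.IsIIDSample P G (Y a N)) →
          TendstoInMeasure P
            (fun (p : ℝ × ℕ) ω => BNPL.WHat Θ Dis (fun i => J p.1 p.2 i ω)
              (fun i => Xpos p.1 p.2 i ω) (fun i => Y p.1 p.2 i ω))
            (atTop ×ˢ atTop) (fun _ => BNPL.W Θ Dis H G))) := by
  have mean : ∀ {a : ℝ} {F : Kernel Ω 𝔛} [IsMarkovKernel F], 0 < a →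
      BNPL.IsDirichletProcess P F a H → P.bind F = H := fun ha h => h.bind_eq ha
  refine ⟨⟨fun a ha F _ X Xpos J Y hDP hX hJ hY => ?_,
    fun n F _ X Xpos J Y hDP hX hJ hY => ?_⟩, fun F _ hF X hX => ⟨fun a ha Xpos J Y hJ hY => ?_,
    fun n Xpos J Y hJ hY => ?_⟩⟩
  -- The envelope is integrable under the mean measure `H` of `F`, hence under almost every
  -- realisation of `F`.
  · have hF : Integrable (BNPL.envelope Θ Dis) (P.bind F) := by rwa [mean ha hDP]
    exact ⟨Measure.ae_integrable_of_integrable_comp hF,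
      BNPL.tendstoInMeasure_posterior_data hΘ hΘne hcont hLip hH hG hF ha hX hJ hY⟩
  -- For every `a` a single data point has law `H`, so `Q = H`.
  · exact BNPL.tendstoInMeasure_posterior_mass hΘ hΘne hcont hLip hH hG hH n
      (fun a ha => (hX a ha).measurable)
      (fun a ha i => ((hX a ha).map_eq i).trans (mean ha (hDP a ha))) hJ hY
  -- A fixed distribution is a constant random measure.
  · have hF' : Integrable (BNPL.envelope Θ Dis) (P.bind (Kernel.const Ω F)) := by simpa using hF
    simpa using BNPL.tendstoInMeasure_posterior_data hΘ hΘne hcont hLip hH hG hF' ha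
      hX.isSampleFromRandom hJ hY
  · exact BNPL.tendstoInMeasure_posterior_mass hΘ hΘne hcont hLip hH hG hF n (X := fun _ => X)
      (fun _ _ => hX.measurable) (fun _ _ => hX.law) hJ hY
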